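/- **Setting.** Let $\mathsf N\ge 1$, let $q,\eta_1,\dots,\eta_{\mathsf N}\in\mathbb C\setminus\{0\}$ with $q^2\neq 1$ and $\eta_a^2\neq q^{2j}\eta_b^2$ for all $a<b$ and $j\in\{-1,0,1\}$. Let $\sigma^z=\begin{pmatrix}1&0\\0&-1\end{pmatrix}$, $\sigma^+=\begin{pmatrix}0&1\\0&0\end{pmatrix}$, $\sigma^-=\begin{pmatrix}0&0\\1&0\end{pmatrix}$, and let $X_n$ denote the action of a $2\times 2$ matrix $X$ on the $n$-th factor of $(\mathbb C^2)^{\otimes \mathsf N}$. Put $$\mathsf L_{n}(\lambda)=\begin{pmatrix}x_+(\lambda)+x_-(\lambda)\sigma_n^z&(q-q^{-1})\sigma_n^-\\(q-q^{-1})\sigma_n^+&x_+(\lambda)-x_-(\lambda)\sigma_n^z\end{pmatrix},\qquad x_\pm(\lambda)=\tfrac12\bigl(\lambda q-(q\lambda)^{-1}\pm(\lambda-\lambda^{-1})\bigr),$$ $$\begin{pmatrix}\mathsf A(\lambda)&\mathsf B(\lambda)\\\mathsf C(\lambda)&\mathsf D(\lambda)\end{pmatrix}=\mathsf L_{\mathsf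 N}(\lambda/\eta_{\mathsf N})\cdots\mathsf L_{1}(\lambda/\eta_1),\qquad \bar{\mathsf T}(\lambda)=\mathsf B(\lambda)+\mathsf C(\lambda),$$ $$a(\lambda)=-\prod_{n=1}^{\mathsf N}\Bigl(\frac{\lambda q}{\eta_n}-\frac{\eta_n}{\lambda q}\Bigr),\qquad d(\lambda)=\prod_{n=1}^{\mathsf N}\Bigl(\frac{\lambda}{\eta_n}-\frac{\eta_n}{\lambda}\Bigr),\qquad \omega(\lambda)=\lambda^{\mathsf N-1}.$$ Let $|0\rangle$, $\langle 0|$ be the all-spins-up vector and its dual covector and, for $h=(h_1,\dots,h_{\mathsf N})\in\{0,1\}^{\mathsf N}$, $$\langle h|=\frac1{\textsc n}\langle 0|\prod_{n=1}^{\mathsf N}\Bigl(\frac{\mathsf C(\eta_n)}{d(\eta_n/q)}\Bigr)^{h_n},\qquad |h\rangle=\frac1{\textsc n}\prod_{n=1}^{\mathsf N}\Bigl(\frac{\mathsf B(\eta_n)}{a(\eta_n)}\Bigr)^{h_n}|0\rangle,\qquad \textsc n=\prod_{b<a}\Bigl(\frac{\eta_a}{\eta_b}-\frac{\eta_b}{\eta_a}\Bigr)^{1/2}.$$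 **Theorem.** Let $\langle t|\neq0$ be a left eigenstate and $|t'\rangle\ne0$ a right eigenstate of the family $\bar{\mathsf T}(\lambda)$, $\lambda\in\mathbb C\setminus\{0\}$, with eigenvalue functions $t(\lambda)$ and $t'(\lambda)$. Then there are functions $\bar Q_t$ and $Q_{t'}$ with $\bar Q_t(\eta_a)\neq0$, $Q_{t'}(\eta_a)\ne0$ and $$\frac{\bar Q_t(\eta_a/q)}{\bar Q_t(\eta_a)}=\frac{t(\eta_a)}{a(\eta_a)},\qquad \frac{Q_{t'}(\eta_a/q)}{Q_{t'}(\eta_a)}=\frac{t'(\eta_a)}{d(\eta_a/q)}\qquad(1\le a\le\mathsf N),$$ such that $$\langle t|=\sum_{h}\prod_{a=1}^{\mathsf N}\frac{\bar Q_t(\eta_aq^{-h_a})}{\omega(\eta_aq^{-h_a})}\prod_{b<a}(\eta_a^2q^{-2h_a}-\eta_b^2q^{-2h_b})\,\langle h|,\qquad |t'\rangle=\sum_{h}\prod_{a=1}^{\mathsf N}\frac{Q_{t'}(\eta_aq^{-h_a})}{\omega(\eta_aq^{-h_a})}\prod_{b<a}(\eta_a^2q^{-2h_a}-\eta_b^2q^{-2h_b})\,|h\rangle,$$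 and for all such $\bar Q_t,Q_{t'}$ and every $n\in\{1,\dots,\mathsf N\}$ $$\langle t|\sigma_n^z|t'\rangle=2\,\frac{\prod_{h=1}^{n-1}t(\eta_h)\prod_{h=1}^{n}t'(\eta_h/q)}{-\prod_{h=1}^{n}a(\eta_h)d(\eta_h/q)}\;\det_{\mathsf N+1}\mathcal S^{(z,t,t')},$$ where $\mathcal S^{(z,t,t')}$ is the $(\mathsf N+1)\times(\mathsf N+1)$ matrix with entries, for $a,b\in\{1,\dots,\mathsf N\}$, $$\mathcal S_{a,b}=\Phi_{a,b}^{(t,t')}=\eta_a^{2(b-1)}\sum_{c=0}^1\frac{Q_{t'}(\eta_aq^{-c})\bar Q_t(\eta_aq^{-c})}{\omega(\eta_aq^{-c})}q^{-2(b-1)c},\qquad \mathcal S_{\mathsf N+1,b}=\eta_n^{2(b-1/2)-\mathsf N},$$ $$\mathcal S_{a,\mathsf N+1}=\frac{Q_{t'}(\eta_a/q)\bar Q_t(\eta_a)}{\omega(\eta_a/q)}\Bigl(\frac{\eta_a}{q}\Bigr)^{\mathsf N-1}d(\eta_a/q),\qquad \mathcal S_{\mathsf N+1,\mathsf N+1}=\frac{t(\eta_n)}2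 .$$ -/

import Mathlib

open scoped Matrix

noncomputable section

namespace AntiperiodicXXZ

/-- Spin configurations of a chain with `N` sites: `0` is spin up (`σᶻ = 1`), `1` is spin down
(`σᶻ = -1`). They index the standard spin basis of the space of states `(ℂ²)^{⊗ N}`. -/
abbrev Conf (N : ℕ) : Type := Fin N → Fin 2

/-- Operators on the space of states `(ℂ²)^{⊗ N}`, as matrices in the spin basis. -/
abbrev Op (N : ℕ) : Type := Matrix (Conf N) (Conf N) ℂ

/-- Vectors (right states) and covectors (left states), by their coordinates in the spin basis
and in its dual basis. -/
abbrev State (N : ℕ) : Type := Conf N → ℂ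

def pauliZ : Matrix (Fin 2) (Fin 2) ℂ := !![1, 0; 0, -1]

/-- The raising matrix `σ⁺`, which sends spin down to spin up. -/
def sigmaPlus : Matrix (Fin 2) (Fin 2) ℂ := !![0, 1; 0, 0]

/-- The lowering matrix `σ⁻`, which sends spin up to spin down. -/
def sigmaMinus : Matrix (Fin 2) (Fin 2) ℂ := !![0, 0; 1, 0]

/-- The operator `X_n` acting as the `2 × 2` matrix `X` on site `n` and as the identity on the
other sites. -/
def localOp {N : ℕ} (n : Fin N) (X : Matrix (Fin 2) (Fin 2) ℂ) : Op N :=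
  Matrix.of fun s s' => X (s n) (s' n) * ∏ m ∈ Finset.univ.erase n, if s m = s' m then 1 else 0

def xPlus (q z : ℂ) : ℂ := (z * q - (q * z)⁻¹ + (z - z⁻¹)) / 2

def xMinus (q z : ℂ) : ℂ := (z * q - (q * z)⁻¹ - (z - z⁻¹)) / 2

/-- The Lax operator of site `n` at spectral parameter `z`, as a `2 × 2` matrix over the auxiliary
space with entries operators on the chain. -/
def lax {N : ℕ} (q : ℂ) (n : Fin N) (z : ℂ) : Matrix (Fin 2) (Fin 2) (Op N) :=
  !![localOp n (xPlus q z • 1 + xMinus q z • pauliZ), localOp n ((q - q⁻¹) • sigmaMinus);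
     localOp n ((q - q⁻¹) • sigmaPlus), localOp n (xPlus q z • 1 - xMinus q z • pauliZ)]

/-- The monodromy matrix `L_N(z / η_N) ⋯ L_1(z / η_1)`. -/
def monodromy {N : ℕ} (q : ℂ) (η : Fin N → ℂ) (z : ℂ) : Matrix (Fin 2) (Fin 2) (Op N) :=
  (List.ofFn fun n : Fin N => lax q n (z / η n)).reverse.prod

/-- The entry `B(z)` of the monodromy matrix. -/
def opB {N : ℕ} (q : ℂ) (η : Fin N → ℂ) (z : ℂ) : Op N := monodromy q η z 0 1

/-- The entry `C(z)` of the monodromy matrix. -/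
def opC {N : ℕ} (q : ℂ) (η : Fin N → ℂ) (z : ℂ) : Op N := monodromy q η z 1 0

/-- The antiperiodic transfer matrix `B(z) + C(z)`. -/
def transfer {N : ℕ} (q : ℂ) (η : Fin N → ℂ) (z : ℂ) : Op N := opB q η z + opC q η z

def aFun {N : ℕ} (q : ℂ) (η : Fin N → ℂ) (z : ℂ) : ℂ :=
  -∏ n, (z * q / η n - η n / (z * q))

def dFun {N : ℕ} (η : Fin N → ℂ) (z : ℂ) : ℂ := ∏ n, (z / η n - η n / z)

/-- The reference state with all spins up, as a vector or as a covector. -/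
def refState (N : ℕ) : State N := Pi.single 0 1

/-- The normalization `∏_{b < a} (η_a / η_b - η_b / η_a)^{1/2}` (principal roots). -/
def normN {N : ℕ} (η : Fin N → ℂ) : ℂ :=
  ∏ a, ∏ b ∈ Finset.Iio a, (η a / η b - η b / η a) ^ (1 / 2 : ℂ)

/-- The covector `⟨h_1, …, h_N|` of the left basis of separation of variables. -/
def leftSOV {N : ℕ} (q : ℂ) (η : Fin N → ℂ) (h : Fin N → Fin 2) : State N :=
  (normN η)⁻¹ • (refState N ᵥ*
    (List.ofFn fun n : Fin N => ((dFun η (η n / q))⁻¹ • opC q η (η n)) ^ (h n : ℕ)).prod)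

/-- The vector `|h_1, …, h_N⟩` of the right basis of separation of variables. -/
def rightSOV {N : ℕ} (q : ℂ) (η : Fin N → ℂ) (h : Fin N → Fin 2) : State N :=
  (normN η)⁻¹ •
    ((List.ofFn fun n : Fin N => ((aFun q η (η n))⁻¹ • opB q η (η n)) ^ (h n : ℕ)).prod *ᵥ
      refState N)

/-- The function `ω(z) = z^{N-1}`. -/
def omegaFun (N : ℕ) (z : ℂ) : ℂ := z ^ ((N : ℤ) - 1)

/-- The coefficient `∏_a Q(η_a q^{-h_a}) / ω(η_a q^{-h_a})`
`∏_{b < a} (η_a² q^{-2 h_a} - η_b² q^{-2 h_b})` of a separate state. -/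
def sepCoeff {N : ℕ} (q : ℂ) (η : Fin N → ℂ) (Q : ℂ → ℂ) (h : Fin N → Fin 2) : ℂ :=
  (∏ a, Q (η a / q ^ (h a : ℕ)) / omegaFun N (η a / q ^ (h a : ℕ))) *
    ∏ a, ∏ b ∈ Finset.Iio a, ((η a / q ^ (h a : ℕ)) ^ 2 - (η b / q ^ (h b : ℕ)) ^ 2)

/-- The left separate state with coefficients `Q`. -/
def leftState {N : ℕ} (q : ℂ) (η : Fin N → ℂ) (Q : ℂ → ℂ) : State N :=
  ∑ h : Fin N → Fin 2, sepCoeff q η Q h • leftSOV q η h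

/-- The right separate state with coefficients `Q`. -/
def rightState {N : ℕ} (q : ℂ) (η : Fin N → ℂ) (Q : ℂ → ℂ) : State N :=
  ∑ h : Fin N → Fin 2, sepCoeff q η Q h • rightSOV q η h

/-- `u` is a left eigenstate of the transfer matrix with eigenvalue function `t`. -/
def IsLeftEigenstate {N : ℕ} (q : ℂ) (η : Fin N → ℂ) (t : ℂ → ℂ) (u : State N) : Prop :=
  u ≠ 0 ∧ ∀ z : ℂ, z ≠ 0 → u ᵥ* transfer q η z = t z • u

/-- `v` is a right eigenstate of the transfer matrix with eigenvalue function `t`. -/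
def IsRightEigenstate {N : ℕ} (q : ℂ) (η : Fin N → ℂ) (t : ℂ → ℂ) (v : State N) : Prop :=
  v ≠ 0 ∧ ∀ z : ℂ, z ≠ 0 → transfer q η z *ᵥ v = t z • v

/-- The relations that characterize the coefficients `Q̄_t` of a left eigenstate. -/
def IsLeftQ {N : ℕ} (q : ℂ) (η : Fin N → ℂ) (t Q : ℂ → ℂ) : Prop :=
  ∀ a, Q (η a) ≠ 0 ∧ Q (η a / q) / Q (η a) = t (η a) / aFun q η (η a)

/-- The relations that characterize the coefficients `Q_t` of a right eigenstate. -/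
def IsRightQ {N : ℕ} (q : ℂ) (η : Fin N → ℂ) (t Q : ℂ → ℂ) : Prop :=
  ∀ a, Q (η a) ≠ 0 ∧ Q (η a / q) / Q (η a) = t (η a) / dFun η (η a / q)

/-- The matrix element `⟨u| X |v⟩`, i.e. the covector `u` applied to `X v`. -/
def matrixElement {N : ℕ} (u : State N) (X : Op N) (v : State N) : ℂ := u ⬝ᵥ (X *ᵥ v)

/-- The matrix `Φ`; the index `b` counts from `0`, so that the usual `2 (b - 1)` is `2 b`. -/
def phiMatrix {N : ℕ} (q : ℂ) (η : Fin N → ℂ) (Qbar Q : ℂ → ℂ) : Matrix (Fin N) (Fin N) ℂ :=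
  Matrix.of fun a b => η a ^ (2 * (b : ℕ)) *
    ∑ c : Fin 2, Q (η a / q ^ (c : ℕ)) * Qbar (η a / q ^ (c : ℕ)) /
      omegaFun N (η a / q ^ (c : ℕ)) / q ^ (2 * (b : ℕ) * (c : ℕ))

/-- The `(N + 1) × (N + 1)` matrix of the form factor of `σᶻ_n`: `Φ` bordered by a column, a row
and a corner. Indices count from `0`, so that the usual exponent `2 (b - 1/2) - N` of the row
is `2 b + 1 - N`. -/
def szMatrix {N : ℕ} (q : ℂ) (η : Fin N → ℂ) (t Qbar Q : ℂ → ℂ) (n : Fin N) :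
    Matrix (Fin N ⊕ Unit) (Fin N ⊕ Unit) ℂ :=
  Matrix.fromBlocks (phiMatrix q η Qbar Q)
    (Matrix.of fun a _ => Q (η a / q) * Qbar (η a) / omegaFun N (η a / q) *
      (η a / q) ^ ((N : ℤ) - 1) * dFun η (η a / q))
    (Matrix.of fun _ b => η n ^ (2 * ((b : ℕ) : ℤ) + 1 - (N : ℤ)))
    (Matrix.of fun _ _ => t (η n) / 2)

end AntiperiodicXXZ

end

noncomputable section

namespace AntiperiodicXXZ

/-! Separation of variables is combined with the solution of the quantum inverse problem. The
exchange relations show that `B(η_a)` annihilates `⟨h|` and `C(η_a)` annihilates `|h⟩` whenever `h_a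
= 0` (`Generic.leftSOV_vecMul_opB`, `Generic.opC_mulVec_rightSOV`). On such states the transfer
matrix at `η_a` only raises `h_a` to `1`, so the coordinates of an eigenstate obey a first-order
recursion in each `h_a` separately, and therefore factorize.

The same annihilation properties make the two families orthogonal. Their norms (`Generic.gram_self`)
follow from two facts: `C(z)` is a Laurent polynomial determined by its values at `N` nodes, and by
the quantum determinant `C(η_a / q)` undoes `B(η_a)`. The norm is a product of powers of nodes
divided by a Vandermonde product, which is exactly what the coefficients of a separate state cancel:
the coordinates are `∏ Q` over the nodes.

For the form factor, the transfer matrix at `η_n` moves site `n` from one end of the chain to the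
other (`chain_rotate`). This turns `σᶻ_n`, up to transfer matrices, into `C(η_n) - B(η_n)`
(`pauliZ_mul_shiftOp`); the eigenvalues left over are rewritten with `t'(η_a) t'(η_a / q) = a(η_a)
d(η_a / q)` (`Generic.eigenvalue_mul`). On `⟨t|` one has `C - B = 2 C - t(η_n)`.

Scalar products of separate states are sums over `h` of a product times a Vandermonde product, hence
`det Φ` by multilinearity. Inserting `C(z)` replaces one row of `Φ` by powers of `z²`
(`Generic.opC_eq_sum_det`), and expanding a bordered determinant (`det_bordered`) collects these
terms into `det S`. -/

/-! ### Algebra of one-site operators -/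

/-- The Kronecker deltas on the other sites leave only configurations that differ at site `n`.
Products and commutators of local operators are checked on vectors through this formula. -/
theorem localOp_mulVec {N : ℕ} (n : Fin N) (X : Matrix (Fin 2) (Fin 2) ℂ) (v : State N)
    (s : Conf N) :
    (localOp n X *ᵥ v) s = ∑ c, X (s n) c * v (Function.update s n c) := by
  classical
  have key : ∀ s' : Conf N, (∏ m ∈ Finset.univ.erase n, if s m = s' m then (1 : ℂ) else 0) =
      if s' = Function.update s n (s' n) then 1 else 0 := by
    intro s'
    rw [Finset.prod_ite_zero]
    simp only [Finset.prod_const_one, Finset.mem_erase, Finset.mem_univ, and_true]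
    congr 1
    rw [eq_iff_iff, funext_iff]
    refine forall_congr' fun m => ?_
    by_cases hm : m = n
    · subst hm; simp
    · simp [hm, eq_comm]
  simp only [Matrix.mulVec, dotProduct, localOp, Matrix.of_apply, key]
  rw [← Finset.sum_fiberwise (g := fun s' : Conf N => s' n)]
  refine Finset.sum_congr rfl fun c _ => ?_
  rw [Finset.sum_eq_single (Function.update s n c)]
  · simp
  · intro b hb hne
    simp only [Finset.mem_filter, Finset.mem_univ, true_and] at hb
    rw [if_neg]
    · simp
    · rw [hb]; exact hne
  · intro h
    simp at h

theorem op_ext {N : ℕ} {M M' : Op N} (h : ∀ v : State N, M *ᵥ v = M' *ᵥ v) : M = M' :=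
  Matrix.mulVec_injective (funext h)

theorem localOp_mul {N : ℕ} (n : Fin N) (X Y : Matrix (Fin 2) (Fin 2) ℂ) :
    localOp n X * localOp n Y = localOp n (X * Y) := by
  refine op_ext fun v => funext fun s => ?_
  rw [← Matrix.mulVec_mulVec]
  simp only [localOp_mulVec, Matrix.mul_apply, Fin.sum_univ_two, Function.update_self,
    Function.update_idem]
  ring

theorem localOp_commute {N : ℕ} {m n : Fin N} (h : m ≠ n) (X Y : Matrix (Fin 2) (Fin 2) ℂ) :
    Commute (localOp m X) (localOp n Y) := by
  refine op_ext fun v => funext fun s => ?_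
  rw [← Matrix.mulVec_mulVec, ← Matrix.mulVec_mulVec]
  simp only [localOp_mulVec, Fin.sum_univ_two, Function.update_of_ne h, Function.update_of_ne h.symm,
    Function.update_comm h]
  ring

theorem localOp_add {N : ℕ} (n : Fin N) (X Y : Matrix (Fin 2) (Fin 2) ℂ) :
    localOp n (X + Y) = localOp n X + localOp n Y := by
  ext s s'
  simp [localOp, add_mul]

theorem localOp_smul {N : ℕ} (n : Fin N) (c : ℂ) (X : Matrix (Fin 2) (Fin 2) ℂ) :
    localOp n (c • X) = c • localOp n X := by
  ext s s'
  simp [localOp, mul_assoc]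

theorem localOp_one {N : ℕ} (n : Fin N) : localOp n 1 = (1 : Op N) := by
  refine op_ext fun v => funext fun s => ?_
  simp [localOp_mulVec, Matrix.one_apply]

/-- `localOp` as a linear map. -/
def localLin {N : ℕ} (n : Fin N) : Matrix (Fin 2) (Fin 2) ℂ →ₗ[ℂ] Op N where
  toFun := localOp n
  map_add' := localOp_add n
  map_smul' := localOp_smul n

theorem localLin_apply {N : ℕ} (n : Fin N) (X : Matrix (Fin 2) (Fin 2) ℂ) :
    localLin n X = localOp n X := rfl

/-! ### Six-vertex weights and exchange relations -/

/-- The weights of the symmetric six-vertex model. -/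
def sixVertex (q z : ℂ) (i j k l : Fin 2) : ℂ :=
  if i = k ∧ j = l then (if i = j then z * q - (q * z)⁻¹ else z - z⁻¹)
  else if i = l ∧ j = k then q - q⁻¹ else 0

/-- The `2 × 2` matrix of weights whose action on a site is an entry of the Lax operator. -/
def laxEntry (q z : ℂ) (i k : Fin 2) : Matrix (Fin 2) (Fin 2) ℂ :=
  Matrix.of fun j l => sixVertex q z i j k l

theorem lax_apply {N : ℕ} (q : ℂ) (n : Fin N) (z : ℂ) (i k : Fin 2) :
    lax q n z i k = localOp n (laxEntry q z i k) := by
  fin_cases i <;> fin_cases k <;> simp only [lax] <;>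
    simp <;> congr 1 <;> ext j l <;> fin_cases j <;> fin_cases l <;>
    simp [laxEntry, sixVertex, pauliZ, sigmaMinus, sigmaPlus, xPlus, xMinus] <;> ring

/-- The exchange relations `R₁₂(z) T₁ T'₂ = T'₂ T₁ R₁₂(z)` with the six-vertex matrix. -/
def ExchangeRel {S : Type*} [Ring S] [Module ℂ S] (q z : ℂ) (T T' : Matrix (Fin 2) (Fin 2) S) :
    Prop :=
  ∀ i j m n, ∑ k, ∑ l, sixVertex q z i j k l • (T k m * T' l n) =
    ∑ k, ∑ l, sixVertex q z k l m n • (T' j l * T i k)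

/-- Entries of `U` commute with those of `T'`, and entries of `U'` with those of `T`, so the weights
can be carried first past `T, T'` and then past `U, U'`. -/
theorem ExchangeRel.mul {S : Type*} [Ring S] [Algebra ℂ S] {q z : ℂ}
    {T T' U U' : Matrix (Fin 2) (Fin 2) S} (hT : ExchangeRel q z T T') (hU : ExchangeRel q z U U')
    (hc : ∀ i j k l, Commute (U i j) (T' k l)) (hc' : ∀ i j k l, Commute (U' i j) (T k l)) :
    ExchangeRel q z (T * U) (T' * U') := by
  intro i j m n
  calc ∑ k, ∑ l, sixVertex q z i j k l • ((T * U) k m * (T' * U') l n)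
      = ∑ p, ∑ r, (∑ k, ∑ l, sixVertex q z i j k l • (T k p * T' l r)) * (U p m * U' r n) := by
        have e : ∀ k l, (T * U) k m * (T' * U') l n
            = ∑ p, ∑ r, (T k p * T' l r) * (U p m * U' r n) := by
          intro k l
          rw [Matrix.mul_apply, Matrix.mul_apply, Finset.sum_mul_sum]
          refine Finset.sum_congr rfl fun p _ => Finset.sum_congr rfl fun r _ => ?_
          rw [mul_assoc, ← mul_assoc (U p m), (hc p m l r).eq, mul_assoc, mul_assoc]
        simp only [e, Fin.sum_univ_two, add_mul, smul_mul_assoc, smul_add]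
        abel
    _ = ∑ k, ∑ l, (T' j l * T i k) * (∑ p, ∑ r, sixVertex q z k l p r • (U p m * U' r n)) := by
        simp only [hT i j]
        simp only [Fin.sum_univ_two, add_mul, mul_add, smul_mul_assoc, mul_smul_comm]
        abel
    _ = ∑ k, ∑ l, sixVertex q z k l m n • ((T' * U') j l * (T * U) i k) := by
        have e : ∀ k l, (T' * U') j l * (T * U) i k
            = ∑ p, ∑ r, (T' j r * T i p) * (U' r l * U p k) := by
          intro k l
          rw [Matrix.mul_apply, Matrix.mul_apply, Finset.sum_mul_sum, Finset.sum_comm]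
          refine Finset.sum_congr rfl fun p _ => Finset.sum_congr rfl fun r _ => ?_
          rw [mul_assoc, ← mul_assoc (U' r l), (hc' r l i p).eq, mul_assoc, mul_assoc]
        simp only [hU _ _ m n, e]
        simp only [Fin.sum_univ_two, mul_add, mul_smul_comm, smul_add]
        abel

theorem ExchangeRel.one {S : Type*} [Ring S] [Module ℂ S] (q z : ℂ) :
    ExchangeRel q z (1 : Matrix (Fin 2) (Fin 2) S) 1 := by
  intro i j m n
  fin_cases i <;> fin_cases j <;> fin_cases m <;> fin_cases n <;>
    simp [sixVertex, Matrix.one_apply]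

-- The Yang–Baxter equation of the six-vertex model, since the Lax entries are the same weights; it
-- is verified entry by entry.
set_option maxHeartbeats 4000000 in
theorem laxEntry_exchangeRel {q x y : ℂ} (hq : q ≠ 0) (hx : x ≠ 0) (hy : y ≠ 0) :
    ExchangeRel q (x / y) (Matrix.of (laxEntry q x)) (Matrix.of (laxEntry q y)) := by
  intro i j m n
  ext s s'
  fin_cases i <;> fin_cases j <;> fin_cases m <;> fin_cases n <;>
    fin_cases s <;> fin_cases s' <;>
    simp [Fin.sum_univ_two, sixVertex, laxEntry, Matrix.mul_apply]
  all_goals first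
    | exact Or.inl (mul_comm _ _)
    | (field_simp; ring)

/-! ### Monodromy of an ordered list of sites -/

/-- The Lax operator of a site, with the two states of the auxiliary space exchanged when the
second component is `true`. -/
def siteLax {N : ℕ} (q : ℂ) (η : Fin N → ℂ) (p : Fin N × Bool) (z : ℂ) :
    Matrix (Fin 2) (Fin 2) (Op N) :=
  Matrix.of fun i k => localOp p.1 (laxEntry q (z / η p.1) (bif p.2 then i + 1 else i)
    (bif p.2 then k + 1 else k))

/-- The monodromy matrix of an ordered list of sites. -/
def chain {N : ℕ} (q : ℂ) (η : Fin N → ℂ) (l : List (Fin N × Bool)) (z : ℂ) :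
    Matrix (Fin 2) (Fin 2) (Op N) :=
  (l.map fun p => siteLax q η p z).prod

theorem chain_nil {N : ℕ} (q : ℂ) (η : Fin N → ℂ) (z : ℂ) : chain q η [] z = 1 := rfl

theorem chain_cons {N : ℕ} (q : ℂ) (η : Fin N → ℂ) (p : Fin N × Bool) (l : List (Fin N × Bool))
    (z : ℂ) : chain q η (p :: l) z = siteLax q η p z * chain q η l z := by
  simp [chain]

theorem chain_append_singleton {N : ℕ} (q : ℂ) (η : Fin N → ℂ) (p : Fin N × Bool)
    (l : List (Fin N × Bool)) (z : ℂ) :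
    chain q η (l ++ [p]) z = chain q η l z * siteLax q η p z := by
  simp [chain]

theorem monodromy_eq_chain {N : ℕ} (q : ℂ) (η : Fin N → ℂ) (z : ℂ) :
    monodromy q η z = chain q η ((List.finRange N).reverse.map fun n => (n, false)) z := by
  have : ∀ n : Fin N, lax q n (z / η n) = siteLax q η (n, false) z := by
    intro n
    ext1 i k
    simp [siteLax, lax_apply]
  simp only [monodromy, chain, List.ofFn_eq_map, List.map_reverse, List.map_map, this]
  rfl

theorem localOp_commute_chain {N : ℕ} (q : ℂ) (η : Fin N → ℂ) {n : Fin N}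
    {l : List (Fin N × Bool)} (h : n ∉ l.map Prod.fst) (X : Matrix (Fin 2) (Fin 2) ℂ) (z : ℂ)
    (i j : Fin 2) : Commute (localOp n X) (chain q η l z i j) := by
  induction l generalizing i j with
  | nil =>
    rw [chain_nil, Matrix.one_apply]
    split_ifs
    · exact Commute.one_right _
    · exact Commute.zero_right _
  | cons p l ih =>
    simp only [List.map_cons, List.mem_cons, not_or] at h
    rw [chain_cons, Matrix.mul_apply]
    exact Commute.sum_right _ _ _ fun k _ => (localOp_commute h.1 _ _).mul_right (ih h.2 k j)

theorem sixVertex_add_one (q z : ℂ) (i j k l : Fin 2) :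
    sixVertex q z (i + 1) (j + 1) (k + 1) (l + 1) = sixVertex q z i j k l := by
  simp [sixVertex]

/-- The inhomogeneity cancels in the ratio of the arguments, so all sites share the weight parameter
`x / y`; this is what allows chains to be multiplied. -/
theorem siteLax_exchangeRel {N : ℕ} {q : ℂ} {η : Fin N → ℂ} (hq : q ≠ 0) (hη : ∀ a, η a ≠ 0)
    (p : Fin N × Bool) {x y : ℂ} (hx : x ≠ 0) (hy : y ≠ 0) :
    ExchangeRel q (x / y) (siteLax q η p x) (siteLax q η p y) := by
  have key := laxEntry_exchangeRel hq (div_ne_zero hx (hη p.1)) (div_ne_zero hy (hη p.1))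
  rw [div_div_div_cancel_right₀ (hη p.1)] at key
  have key' : ExchangeRel q (x / y) (Matrix.of fun i k => localOp p.1 (laxEntry q (x / η p.1) i k))
      (Matrix.of fun i k => localOp p.1 (laxEntry q (y / η p.1) i k)) := by
    intro i j m n
    have := congrArg (localLin p.1) (key i j m n)
    simpa only [map_sum, map_smul, Matrix.of_apply, localLin_apply, ← localOp_mul] using this
  rcases p with ⟨a, _ | _⟩
  · exact key'
  · intro i j m n
    have h1 := key' (i + 1) (j + 1) (m + 1) (n + 1)
    -- For a flipped site, all auxiliary indices are shifted by one; the weights do not change under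
    -- a simultaneous flip.
    rw [← Equiv.sum_comp (Equiv.addRight (1 : Fin 2)), ← Equiv.sum_comp (Equiv.addRight (1 : Fin 2))
      (fun k => ∑ l, sixVertex q (x / y) k l _ _ • _)] at h1
    simp_rw [← Equiv.sum_comp (Equiv.addRight (1 : Fin 2)) (fun l => sixVertex q (x / y) _ l _ _ • _)]
      at h1
    simp_rw [← Equiv.sum_comp (Equiv.addRight (1 : Fin 2)) (fun l => sixVertex q (x / y) _ _ _ l • _)]
      at h1
    simp only [Equiv.coe_addRight, sixVertex_add_one] at h1
    exact h1

theorem chain_exchangeRel {N : ℕ} {q : ℂ} {η : Fin N → ℂ} (hq : q ≠ 0) (hη : ∀ a, η a ≠ 0)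
    {l : List (Fin N × Bool)} (hl : (l.map Prod.fst).Nodup) {x y : ℂ} (hx : x ≠ 0) (hy : y ≠ 0) :
    ExchangeRel q (x / y) (chain q η l x) (chain q η l y) := by
  induction l with
  | nil => exact ExchangeRel.one q _
  | cons p l ih =>
    rw [List.map_cons, List.nodup_cons] at hl
    rw [chain_cons, chain_cons]
    exact (siteLax_exchangeRel hq hη p hx hy).mul (ih hl.2)
      (fun i j k l => (localOp_commute_chain q η hl.1 _ _ _ _).symm)
      (fun i j k l => (localOp_commute_chain q η hl.1 _ _ _ _).symm)

/-- The entry `A(z)` of the monodromy matrix. -/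
def opA {N : ℕ} (q : ℂ) (η : Fin N → ℂ) (z : ℂ) : Op N := monodromy q η z 0 0

/-- The entry `D(z)` of the monodromy matrix. -/
def opD {N : ℕ} (q : ℂ) (η : Fin N → ℂ) (z : ℂ) : Op N := monodromy q η z 1 1

theorem monodromy_exchangeRel {N : ℕ} {q : ℂ} {η : Fin N → ℂ} (hq : q ≠ 0) (hη : ∀ a, η a ≠ 0)
    {x y : ℂ} (hx : x ≠ 0) (hy : y ≠ 0) :
    ExchangeRel q (x / y) (monodromy q η x) (monodromy q η y) := by
  rw [monodromy_eq_chain, monodromy_eq_chain]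
  refine chain_exchangeRel hq hη ?_ hx hy
  rw [List.map_map]
  simpa [Function.comp_def] using List.nodup_finRange N

/-! ### Exchange relations between the monodromy entries -/

section Relations

variable {N : ℕ} {q : ℂ} {η : Fin N → ℂ} {x y : ℂ}

theorem opC_mul_opC (hq : q ≠ 0) (hη : ∀ a, η a ≠ 0) (hx : x ≠ 0) (hy : y ≠ 0)
    (h : x / y * q - (q * (x / y))⁻¹ ≠ 0) :
    opC q η x * opC q η y = opC q η y * opC q η x := by
  have := monodromy_exchangeRel hq hη hx hy 1 1 0 0
  simp only [sixVertex, Fin.sum_univ_two] at this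
  simp [-mul_inv_rev, -inv_div] at this
  exact smul_right_injective _ h this

theorem opB_mul_opB (hq : q ≠ 0) (hη : ∀ a, η a ≠ 0) (hx : x ≠ 0) (hy : y ≠ 0)
    (h : x / y * q - (q * (x / y))⁻¹ ≠ 0) :
    opB q η x * opB q η y = opB q η y * opB q η x := by
  have := monodromy_exchangeRel hq hη hx hy 0 0 1 1
  simp only [sixVertex, Fin.sum_univ_two] at this
  simp [-mul_inv_rev, -inv_div] at this
  exact smul_right_injective _ h this

theorem opC_mul_opD (hq : q ≠ 0) (hη : ∀ a, η a ≠ 0) (hx : x ≠ 0) (hy : y ≠ 0) :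
    (x / y * q - (q * (x / y))⁻¹) • (opD q η x * opC q η y) =
      (x / y - (x / y)⁻¹) • (opC q η y * opD q η x) + (q - q⁻¹) • (opD q η y * opC q η x) := by
  have := monodromy_exchangeRel hq hη hx hy 1 1 1 0
  simp only [sixVertex, Fin.sum_univ_two] at this
  simp [-mul_inv_rev, -inv_div] at this
  rw [add_comm] at this
  exact this

theorem opD_mul_opB (hq : q ≠ 0) (hη : ∀ a, η a ≠ 0) (hx : x ≠ 0) (hy : y ≠ 0) :
    (x / y - (x / y)⁻¹) • (opD q η x * opB q η y) + (q - q⁻¹) • (opB q η x * opD q η y) =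
      (x / y * q - (q * (x / y))⁻¹) • (opB q η y * opD q η x) := by
  have := monodromy_exchangeRel hq hη hx hy 1 0 1 1
  simp only [sixVertex, Fin.sum_univ_two] at this
  simp [-mul_inv_rev, -inv_div] at this
  rw [add_comm] at this
  exact this

/-- Here `D` stands next to a vector, and in `opC_mul_opB_of_left` next to a covector, so that on
either basis the extra terms are removed by the vanishing of `D(η_a)`. -/
theorem opC_mul_opB_of_right (hq : q ≠ 0) (hη : ∀ a, η a ≠ 0) (hx : x ≠ 0) (hy : y ≠ 0) :
    (x / y - (x / y)⁻¹) • (opC q η x * opB q η y) + (q - q⁻¹) • (opA q η x * opD q η y) =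
      (x / y - (x / y)⁻¹) • (opB q η y * opC q η x) + (q - q⁻¹) • (opA q η y * opD q η x) := by
  have := monodromy_exchangeRel hq hη hx hy 1 0 0 1
  simp only [sixVertex, Fin.sum_univ_two] at this
  simp [-mul_inv_rev, -inv_div] at this
  rw [add_comm] at this
  exact this

theorem opC_mul_opB_of_left (hq : q ≠ 0) (hη : ∀ a, η a ≠ 0) (hx : x ≠ 0) (hy : y ≠ 0) :
    (x / y - (x / y)⁻¹) • (opB q η x * opC q η y) + (q - q⁻¹) • (opD q η x * opA q η y) =
      (x / y - (x / y)⁻¹) • (opC q η y * opB q η x) + (q - q⁻¹) • (opD q η y * opA q η x) := by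
  have := monodromy_exchangeRel hq hη hx hy 0 1 1 0
  simp only [sixVertex, Fin.sum_univ_two] at this
  simp [-mul_inv_rev, -inv_div] at this
  rw [add_comm (_ • (opC q η y * opB q η x))]
  exact this

theorem opA_mul_opD_exchange (hq : q ≠ 0) (hη : ∀ a, η a ≠ 0) (hx : x ≠ 0) (hy : y ≠ 0) :
    (x / y - (x / y)⁻¹) • (opA q η x * opD q η y) + (q - q⁻¹) • (opC q η x * opB q η y) =
      (x / y - (x / y)⁻¹) • (opD q η y * opA q η x) + (q - q⁻¹) • (opC q η y * opB q η x) := by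
  have := monodromy_exchangeRel hq hη hx hy 0 1 0 1
  simp only [sixVertex, Fin.sum_univ_two] at this
  simp [-mul_inv_rev, -inv_div] at this
  exact this

end Relations

/-! ### Quantum determinant -/

/-- The adjugate of a `2 × 2` matrix over a ring. -/
def crossed {S : Type*} [Ring S] (T : Matrix (Fin 2) (Fin 2) S) : Matrix (Fin 2) (Fin 2) S :=
  !![T 1 1, -T 0 1; -T 1 0, T 0 0]

theorem crossed_mul {S : Type*} [Ring S] {T U : Matrix (Fin 2) (Fin 2) S}
    (hc : ∀ i j k l, Commute (T i j) (U k l)) : crossed (T * U) = crossed U * crossed T := by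
  have h : ∀ i j k l, U i j * T k l = T k l * U i j := fun i j k l => (hc k l i j).symm.eq
  ext i j
  fin_cases i <;> fin_cases j <;>
    simp [crossed, Matrix.mul_apply, Fin.sum_univ_two, h] <;> abel

theorem siteLax_mul_crossed {N : ℕ} {q : ℂ} {η : Fin N → ℂ} (hq : q ≠ 0) (hη : ∀ a, η a ≠ 0)
    (n : Fin N) {z : ℂ} (hz : z ≠ 0) :
    siteLax q η (n, false) z * crossed (siteLax q η (n, false) (z / q)) =
      ((z * q / η n - η n / (z * q)) * (z / q / η n - η n / (z / q))) •
        (1 : Matrix (Fin 2) (Fin 2) (Op N)) := by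
  have hn := hη n
  have neg : ∀ X : Matrix (Fin 2) (Fin 2) ℂ, -localOp n X = localOp n (-X) :=
    fun X => (map_neg (localLin n) X).symm
  ext1 i j
  simp only [Matrix.mul_apply, Fin.sum_univ_two, Matrix.smul_apply]
  trans localOp n (((z * q / η n - η n / (z * q)) * (z / q / η n - η n / (z / q))) •
    (if i = j then 1 else 0))
  · fin_cases i <;> fin_cases j <;> simp only [siteLax, crossed] <;>
      simp only [Matrix.of_apply, Matrix.cons_val', Matrix.cons_val_zero, Matrix.cons_val_one,
        Fin.zero_eta, Fin.mk_one, cond_false, Matrix.cons_val_fin_one, neg, localOp_mul,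
        ← localOp_add] <;> congr 1 <;> ext s s' <;> fin_cases s <;> fin_cases s' <;>
      simp [laxEntry, sixVertex, Matrix.mul_apply, Fin.sum_univ_two] <;>
      first
        | (field_simp; ring1)
        | exact Or.inl (by ring1)
  · rw [localOp_smul]
    congr 1
    rw [Matrix.one_apply]
    split_ifs
    · exact localOp_one n
    · exact map_zero (localLin n)

/-- The adjugate reverses products of mutually commuting factors, so the product collapses from the
inside out, one site giving one scalar. -/
theorem chain_mul_crossed {N : ℕ} {q : ℂ} {η : Fin N → ℂ} (hq : q ≠ 0) (hη : ∀ a, η a ≠ 0)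
    {l : List (Fin N)} (hl : l.Nodup) {z : ℂ} (hz : z ≠ 0) :
    chain q η (l.map fun n => (n, false)) z * crossed (chain q η (l.map fun n => (n, false)) (z / q))
      = (l.map fun n => (z * q / η n - η n / (z * q)) * (z / q / η n - η n / (z / q))).prod •
        (1 : Matrix (Fin 2) (Fin 2) (Op N)) := by
  induction l with
  | nil =>
    simp only [List.map_nil, chain_nil, List.prod_nil, one_smul, one_mul]
    ext1 i j
    fin_cases i <;> fin_cases j <;> simp [crossed]
  | cons n l ih =>
    rw [List.nodup_cons] at hl
    simp only [List.map_cons, chain_cons, List.prod_cons]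
    rw [crossed_mul, mul_assoc, ← mul_assoc (chain q η _ z), ih hl.2, smul_mul_assoc, one_mul,
      mul_smul_comm, siteLax_mul_crossed hq hη n hz, smul_smul, mul_comm]
    intro i j k m
    exact localOp_commute_chain q η (by simpa [Function.comp_def] using hl.1) _ _ _ _

theorem monodromy_mul_crossed {N : ℕ} {q : ℂ} {η : Fin N → ℂ} (hq : q ≠ 0) (hη : ∀ a, η a ≠ 0)
    {z : ℂ} (hz : z ≠ 0) :
    monodromy q η z * crossed (monodromy q η (z / q)) =
      (-(aFun q η z * dFun η (z / q))) • (1 : Matrix (Fin 2) (Fin 2) (Op N)) := by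
  rw [monodromy_eq_chain, monodromy_eq_chain,
    chain_mul_crossed hq hη (List.nodup_reverse.2 (List.nodup_finRange N)) hz]
  congr 1
  rw [List.map_reverse, List.prod_reverse, ← List.ofFn_eq_map, List.prod_ofFn,
    Finset.prod_mul_distrib, aFun, dFun, neg_mul, neg_neg]

theorem quantum_det {N : ℕ} {q : ℂ} {η : Fin N → ℂ} (hq : q ≠ 0) (hη : ∀ a, η a ≠ 0)
    {z : ℂ} (hz : z ≠ 0) :
    opC q η z * opB q η (z / q) =
      opD q η z * opA q η (z / q) + (aFun q η z * dFun η (z / q)) • (1 : Op N) := by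
  have := congrFun (congrFun (monodromy_mul_crossed hq hη hz) 1) 1
  simp [Matrix.mul_apply, Fin.sum_univ_two, crossed] at this
  rw [opA, opB, opC, opD, ← neg_eq_iff_eq_neg.2 this]
  abel

/-- The form with `D` on the right, for use on vectors. At ratio `1 / q` the two coefficients of the
exchange relation of `A` and `D` are opposite, and `q² ≠ 1` allows cancelling them. -/
theorem quantum_det' {N : ℕ} {q : ℂ} {η : Fin N → ℂ} (hq : q ≠ 0) (hq2 : q ^ 2 ≠ 1)
    (hη : ∀ a, η a ≠ 0) {z : ℂ} (hz : z ≠ 0) :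
    opC q η (z / q) * opB q η z =
      opA q η (z / q) * opD q η z + (aFun q η z * dFun η (z / q)) • (1 : Op N) := by
  have h1 := quantum_det hq hη hz
  have h2 := opA_mul_opD_exchange hq hη (div_ne_zero hz hq) hz
  have h3 : z / q / z - (z / q / z)⁻¹ = -(q - q⁻¹) := by field_simp; ring
  have h4 : q - q⁻¹ ≠ 0 := by
    intro h
    apply hq2
    field_simp at h
    linear_combination h
  rw [h3, neg_smul, neg_smul, ← smul_neg, ← smul_neg, ← smul_add, ← smul_add] at h2
  have h5 := smul_right_injective _ h4 h2
  have h6 : opC q η (z / q) * opB q η z =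
      opC q η z * opB q η (z / q) - opD q η z * opA q η (z / q) + opA q η (z / q) * opD q η z := by
    rw [neg_add_eq_iff_eq_add] at h5
    rw [h5]; abel
  rw [h6, h1]; abel

/-! ### Laurent degree in the spectral parameter and interpolation -/

/-- `z ^ m * F z` is a polynomial of degree at most `m` in `z ^ 2`, away from `z = 0`. -/
def LaurentBound (m : ℕ) (F : ℂ → ℂ) : Prop :=
  ∃ p : Polynomial ℂ, p.natDegree ≤ m ∧ ∀ z, z ≠ 0 → z ^ m * F z = p.eval (z ^ 2)

theorem LaurentBound.const (c : ℂ) : LaurentBound 0 fun _ => c :=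
  ⟨Polynomial.C c, by simp, by simp⟩

theorem LaurentBound.zero (m : ℕ) : LaurentBound m fun _ => 0 := ⟨0, by simp, by simp⟩

theorem LaurentBound.add {m : ℕ} {F G : ℂ → ℂ} (hF : LaurentBound m F) (hG : LaurentBound m G) :
    LaurentBound m fun z => F z + G z := by
  obtain ⟨p, hp, hp'⟩ := hF
  obtain ⟨r, hr, hr'⟩ := hG
  exact ⟨p + r, Polynomial.natDegree_add_le_of_degree_le hp hr, fun z hz => by
    rw [mul_add, hp' z hz, hr' z hz, Polynomial.eval_add]⟩

theorem LaurentBound.mul {m n : ℕ} {F G : ℂ → ℂ} (hF : LaurentBound m F) (hG : LaurentBound n G) :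
    LaurentBound (m + n) fun z => F z * G z := by
  obtain ⟨p, hp, hp'⟩ := hF
  obtain ⟨r, hr, hr'⟩ := hG
  exact ⟨p * r, Polynomial.natDegree_mul_le_of_le hp hr, fun z hz => by
    rw [Polynomial.eval_mul, ← hp' z hz, ← hr' z hz]; ring⟩

theorem LaurentBound.add_two {m : ℕ} {F : ℂ → ℂ} (hF : LaurentBound m F) :
    LaurentBound (m + 2) F := by
  obtain ⟨p, hp, hp'⟩ := hF
  refine ⟨p * Polynomial.X, (Polynomial.natDegree_mul_le_of_le hp
    Polynomial.natDegree_X_le).trans (by omega), fun z hz => ?_⟩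
  rw [Polynomial.eval_mul, ← hp' z hz, Polynomial.eval_X]
  ring

theorem LaurentBound.sum {ι : Type*} {m : ℕ} {F : ι → ℂ → ℂ} (s : Finset ι)
    (hF : ∀ i, LaurentBound m (F i)) : LaurentBound m fun z => ∑ i ∈ s, F i z := by
  classical
  induction s using Finset.induction_on with
  | empty => simpa using LaurentBound.zero m
  | insert a s ha ih => simpa [Finset.sum_insert ha] using (hF a).add ih

/-- The entries of an operator-valued function satisfy `LaurentBound m`. -/
def OpBound {N : ℕ} (m : ℕ) (F : ℂ → Op N) : Prop := ∀ s s', LaurentBound m fun z => F z s s'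

theorem OpBound.mul {N m n : ℕ} {F G : ℂ → Op N} (hF : OpBound m F) (hG : OpBound n G) :
    OpBound (m + n) fun z => F z * G z := fun s s' => by
  simp only [Matrix.mul_apply]
  exact LaurentBound.sum _ fun r => (hF s r).mul (hG r s')

theorem OpBound.add {N m : ℕ} {F G : ℂ → Op N} (hF : OpBound m F) (hG : OpBound m G) :
    OpBound m fun z => F z + G z := fun s s' => (hF s s').add (hG s s')

theorem OpBound.const {N : ℕ} (M : Op N) : OpBound 0 fun _ => M := fun _ _ => LaurentBound.const _

theorem LaurentBound.smul_sub_inv {c : ℂ} (hc : c ≠ 0) :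
    LaurentBound 1 fun z => z * c - (z * c)⁻¹ := by
  refine ⟨Polynomial.C c * Polynomial.X - Polynomial.C c⁻¹, ?_, fun z hz => ?_⟩
  · refine (Polynomial.natDegree_sub_le _ _).trans (max_le ?_ (by simp))
    exact Polynomial.natDegree_C_mul_le c _ |>.trans Polynomial.natDegree_X_le
  · simp
    field_simp

theorem opBound_siteLax_diag {N : ℕ} {q : ℂ} {η : Fin N → ℂ} (hq : q ≠ 0) (hη : ∀ a, η a ≠ 0)
    (n : Fin N) (i : Fin 2) : OpBound 1 fun z => siteLax q η (n, false) z i i := by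
  intro s s'
  have h : LaurentBound 1 fun z => laxEntry q (z / η n) i i (s n) (s' n) := by
    have h1 := LaurentBound.smul_sub_inv (inv_ne_zero (hη n))
    have h2 := LaurentBound.smul_sub_inv (mul_ne_zero (inv_ne_zero (hη n)) hq)
    simp only [laxEntry, sixVertex, Matrix.of_apply, true_and]
    split_ifs
    · convert h2 using 2 with z
      rw [mul_comm q, div_eq_mul_inv, mul_assoc]
    · simpa only [div_eq_mul_inv] using h1
    · exact absurd (by simp_all) ‹¬ s n = s' n›
    · exact LaurentBound.zero 1
  simpa [siteLax, localOp] using h.mul (LaurentBound.const _)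

theorem opBound_siteLax_off {N : ℕ} (q : ℂ) (η : Fin N → ℂ) (n : Fin N) {i j : Fin 2}
    (h : i ≠ j) : OpBound 0 fun z => siteLax q η (n, false) z i j := by
  intro s s'
  have h : LaurentBound 0 fun z => laxEntry q (z / η n) i j (s n) (s' n) := by
    simp only [laxEntry, sixVertex, Matrix.of_apply, h, false_and, if_false]
    exact LaurentBound.const _
  simpa [siteLax, localOp] using h.mul (LaurentBound.const _)

/-- Diagonal Lax entries have degree one and off-diagonal ones are constant. An off-diagonal entry
of the product uses an odd number of the latter, so it loses at least one degree. -/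
theorem opBound_chain {N : ℕ} {q : ℂ} {η : Fin N → ℂ} (hq : q ≠ 0) (hη : ∀ a, η a ≠ 0)
    (l : List (Fin N)) (n : Fin N) (i j : Fin 2) :
    OpBound (if i = j then l.length + 1 else l.length)
      fun z => chain q η ((n :: l).map fun n => (n, false)) z i j := by
  induction l generalizing n i j with
  | nil =>
    simp only [List.map_cons, List.map_nil, chain_cons, chain_nil, mul_one]
    split_ifs with h
    · subst h; exact opBound_siteLax_diag hq hη n i
    · exact opBound_siteLax_off q η n h
  | cons m l ih =>
    have ih' := ih m
    rw [List.map_cons]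
    simp only [chain_cons q η (n, false), Matrix.mul_apply, List.length_cons]
    have hd := opBound_siteLax_diag hq hη n
    have ho := fun i j => opBound_siteLax_off q η n (i := i) (j := j)
    simp only [Fin.sum_univ_two]
    -- A path with two off-diagonal factors has degree smaller by two; the parity is unchanged, so
    -- the weaker bound holds as well.
    have two : ∀ {F : ℂ → Op N}, OpBound l.length F → OpBound (l.length + 1 + 1) F :=
      fun h s s' => (h s s').add_two
    have e : 1 + (l.length + 1) = l.length + 1 + 1 := by omega
    have e' : 1 + l.length = l.length + 1 := by omega
    fin_cases i <;> fin_cases j <;> refine OpBound.add ?_ ?_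
    · simpa [e] using (hd 0).mul (ih' 0 0)
    · simpa using two (by simpa using (ho 0 1 (by simp)).mul (ih' 1 0))
    · simpa [e'] using (hd 0).mul (ih' 0 1)
    · simpa using (ho 0 1 (by simp)).mul (ih' 1 1)
    · simpa using (ho 1 0 (by simp)).mul (ih' 0 0)
    · simpa [e'] using (hd 1).mul (ih' 1 0)
    · simpa using two (by simpa using (ho 1 0 (by simp)).mul (ih' 0 1))
    · simpa [e] using (hd 1).mul (ih' 1 1)

theorem opBound_opC {N : ℕ} {q : ℂ} {η : Fin N → ℂ} (hq : q ≠ 0) (hη : ∀ a, η a ≠ 0) :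
    OpBound (N - 1) (opC q η) := by
  have hl : ((List.finRange N).reverse).length = N := by simp
  rcases h : (List.finRange N).reverse with _ | ⟨n, l⟩
  · have : ∀ z, opC q η z = 0 := by
      intro z
      rw [opC, monodromy_eq_chain, h]
      simp [chain_nil]
    intro s s'
    simpa [this] using LaurentBound.zero (N - 1)
  · rw [h, List.length_cons] at hl
    have := opBound_chain hq hη l n 1 0
    rw [← h] at this
    simp only [← monodromy_eq_chain] at this
    rw [show l.length = N - 1 by omega, if_neg (by simp)] at this
    exact this

theorem LaurentBound.interpolate {N : ℕ} (hN : 0 < N) {F : ℂ → ℂ} (hF : LaurentBound (N - 1) F)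
    {x : Fin N → ℂ} (hx : ∀ a, x a ≠ 0) (hinj : Function.Injective fun a => x a ^ 2) {z : ℂ}
    (hz : z ≠ 0) :
    z ^ (N - 1) * F z = ∑ a, x a ^ (N - 1) * F (x a) *
      ∏ b ∈ Finset.univ.erase a, (z ^ 2 - x b ^ 2) / (x a ^ 2 - x b ^ 2) := by
  obtain ⟨p, hp, hp'⟩ := hF
  have hdeg : p.degree < (Finset.univ : Finset (Fin N)).card := by
    rw [Finset.card_univ, Fintype.card_fin]
    exact Polynomial.degree_le_natDegree.trans_lt (by exact_mod_cast (by omega))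
  have := congrArg (Polynomial.eval (z ^ 2))
    (Lagrange.eq_interpolate (s := Finset.univ) (v := fun a => x a ^ 2) hinj.injOn hdeg)
  rw [hp' z hz, this, Lagrange.interpolate_apply, Polynomial.eval_finsetSum]
  refine Finset.sum_congr rfl fun a _ => ?_
  rw [Polynomial.eval_mul, Polynomial.eval_C, hp' _ (hx a), Lagrange.basis, Polynomial.eval_prod]
  congr 1
  refine Finset.prod_congr rfl fun b _ => ?_
  rw [Lagrange.basisDivisor]
  simp
  rw [div_eq_inv_mul]

theorem LaurentBound.eq_zero {m : ℕ} {F : ℂ → ℂ} (hF : LaurentBound m F) (c : ℂ)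
    (h : ∀ z, z ≠ 0 → z ^ 2 ≠ c → F z = 0) {z : ℂ} (hz : z ≠ 0) : F z = 0 := by
  obtain ⟨p, -, hp⟩ := hF
  have hp0 : p = 0 := by
    refine Polynomial.eq_zero_of_infinite_isRoot p ?_
    have hinf : (({0, c} : Set ℂ)ᶜ).Infinite := (Set.toFinite _).infinite_compl
    refine hinf.mono fun w hw => ?_
    simp only [Set.mem_compl_iff, Set.mem_insert_iff, Set.mem_singleton_iff, not_or] at hw
    obtain ⟨y, hy⟩ := IsAlgClosed.exists_pow_nat_eq w (n := 2) (by norm_num)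
    have hy0 : y ≠ 0 := by rintro rfl; simp at hy; exact hw.1 hy.symm
    simp only [Set.mem_ofPred_eq, Polynomial.IsRoot.def]
    rw [← hy, ← hp y hy0, h y hy0 (hy ▸ hw.2), mul_zero]
  have := hp z hz
  rw [hp0, Polynomial.eval_zero] at this
  exact (mul_eq_zero.1 this).resolve_left (pow_ne_zero _ hz)

/-- The exchange relation gives commutation only where its coefficient is nonzero; polynomiality in
`z²` removes the exception. It is needed for `C(η_a)` and `C(η_a / q)`, whose coefficient vanishes
when `q⁴ = 1`. -/
theorem opC_commute {N : ℕ} {q : ℂ} {η : Fin N → ℂ} (hq : q ≠ 0) (hη : ∀ a, η a ≠ 0) {x y : ℂ}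
    (hx : x ≠ 0) (hy : y ≠ 0) : opC q η x * opC q η y = opC q η y * opC q η x := by
  have hb := opBound_opC hq hη
  have hc := OpBound.const (opC q η y)
  have h1 : OpBound (N - 1) fun z => opC q η z * opC q η y := hb.mul hc
  have h2 : OpBound (N - 1) fun z => (-opC q η y) * opC q η z := by
    simpa using (OpBound.const (-opC q η y)).mul hb
  ext s s'
  -- The coefficient of the exchange relation vanishes exactly at `z² = y² / q²`.
  have := (h1.add h2 s s').eq_zero (y ^ 2 / q ^ 2) ?_ hx
  · simpa [← sub_eq_add_neg, sub_eq_zero] using this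
  · intro z hz hz2
    change (opC q η z * opC q η y + -opC q η y * opC q η z) s s' = 0
    rw [opC_mul_opC hq hη hz hy]
    · simp
    · intro h
      apply hz2
      field_simp at h
      field_simp
      linear_combination h

/-! ### Action of the monodromy on the reference state -/

theorem refState_vecMul_localOp {N : ℕ} (n : Fin N) {X : Matrix (Fin 2) (Fin 2) ℂ}
    (h : X 0 1 = 0) : refState N ᵥ* localOp n X = X 0 0 • refState N := by
  ext s
  simp only [refState, Matrix.single_one_vecMul, Matrix.row_apply, localOp, Matrix.of_apply,
    Pi.zero_apply, Pi.smul_apply, smul_eq_mul, Finset.prod_ite_zero, Finset.prod_const_one,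
    Pi.single_apply]
  by_cases hs : s = 0
  · subst hs; simp
  · rw [if_neg hs]
    by_cases hn : s n = 0
    · rw [if_neg, mul_zero, mul_zero]
      intro h'
      refine hs (funext fun m => ?_)
      by_cases hm : m = n
      · rw [hm, hn]; rfl
      · exact (h' m (by simp [hm])).symm
    · rw [Fin.eq_one_of_ne_zero _ hn, h]; simp

theorem localOp_mulVec_refState {N : ℕ} (n : Fin N) {X : Matrix (Fin 2) (Fin 2) ℂ}
    (h : X 1 0 = 0) : localOp n X *ᵥ refState N = X 0 0 • refState N := by
  ext s
  simp only [refState, Matrix.mulVec_single_one, Matrix.col_apply, localOp, Matrix.of_apply,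
    Pi.zero_apply, Pi.smul_apply, smul_eq_mul, Finset.prod_ite_zero, Finset.prod_const_one,
    Pi.single_apply]
  by_cases hs : s = 0
  · subst hs; simp
  · rw [if_neg hs]
    by_cases hn : s n = 0
    · rw [if_neg, mul_zero, mul_zero]
      intro h'
      refine hs (funext fun m => ?_)
      by_cases hm : m = n
      · rw [hm, hn]; rfl
      · exact (h' m (by simp [hm]))
    · rw [Fin.eq_one_of_ne_zero _ hn, h]; simp

/-- The two entries are treated together because the recursion for `D` involves the entry `B` of the
shorter chain. -/
theorem refState_vecMul_chain {N : ℕ} (q : ℂ) (η : Fin N → ℂ) (z : ℂ) {l : List (Fin N)}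
    (hl : l.Nodup) :
    refState N ᵥ* chain q η (l.map fun n => (n, false)) z 0 1 = 0 ∧
    refState N ᵥ* chain q η (l.map fun n => (n, false)) z 1 1 =
      (l.map fun n => z / η n - (z / η n)⁻¹).prod • refState N := by
  induction l with
  | nil => simp [chain_nil]
  | cons n l ih =>
    rw [List.nodup_cons] at hl
    obtain ⟨ih1, ih2⟩ := ih hl.2
    have hc : Commute (siteLax q η (n, false) z 1 0) (chain q η (l.map fun n => (n, false)) z 0 1) :=
      localOp_commute_chain q η (by simpa [Function.comp_def] using hl.1) _ _ _ _
    have h00 : refState N ᵥ* siteLax q η (n, false) z 0 0 = _ :=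
      refState_vecMul_localOp n (by simp [laxEntry, sixVertex])
    have h01 : refState N ᵥ* siteLax q η (n, false) z 0 1 = _ :=
      refState_vecMul_localOp n (by simp [laxEntry, sixVertex])
    have h11 : refState N ᵥ* siteLax q η (n, false) z 1 1 = _ :=
      refState_vecMul_localOp n (by simp [laxEntry, sixVertex])
    simp only [List.map_cons, chain_cons, Matrix.mul_apply, Fin.sum_univ_two, Matrix.vecMul_add,
      List.prod_cons]
    constructor
    · rw [← Matrix.vecMul_vecMul, ← Matrix.vecMul_vecMul, h00, h01, Matrix.smul_vecMul, ih1]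
      simp [laxEntry, sixVertex]
    -- The raising entry of the site does not fix the reference covector; it is moved to the right
    -- of the entry `B` of the rest, which annihilates it.
    · rw [hc.eq, ← Matrix.vecMul_vecMul, ← Matrix.vecMul_vecMul, h11, ih1, Matrix.smul_vecMul, ih2]
      simp [laxEntry, sixVertex, smul_smul]

theorem chain_mulVec_refState {N : ℕ} (q : ℂ) (η : Fin N → ℂ) (z : ℂ) {l : List (Fin N)}
    (hl : l.Nodup) :
    chain q η (l.map fun n => (n, false)) z 1 0 *ᵥ refState N = 0 ∧
    chain q η (l.map fun n => (n, false)) z 1 1 *ᵥ refState N =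
      (l.map fun n => z / η n - (z / η n)⁻¹).prod • refState N := by
  induction l with
  | nil => simp [chain_nil]
  | cons n l ih =>
    rw [List.nodup_cons] at hl
    obtain ⟨ih1, ih2⟩ := ih hl.2
    have hc : ∀ j, Commute (siteLax q η (n, false) z 1 0)
        (chain q η (l.map fun n => (n, false)) z 0 j) := fun j =>
      localOp_commute_chain q η (by simpa [Function.comp_def] using hl.1) _ _ _ _
    have h10 : siteLax q η (n, false) z 1 0 *ᵥ refState N = _ :=
      localOp_mulVec_refState n (by simp [laxEntry, sixVertex])
    have h11 : siteLax q η (n, false) z 1 1 *ᵥ refState N = _ :=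
      localOp_mulVec_refState n (by simp [laxEntry, sixVertex])
    simp only [List.map_cons, chain_cons, Matrix.mul_apply, Fin.sum_univ_two, Matrix.add_mulVec,
      List.prod_cons, (hc _).eq]
    simp only [← Matrix.mulVec_mulVec, h10, h11, ih1, ih2, Matrix.mulVec_smul]
    constructor
    · simp [laxEntry, sixVertex]
    · simp [laxEntry, sixVertex, smul_smul, mul_comm]

theorem refState_vecMul_opB {N : ℕ} (q : ℂ) (η : Fin N → ℂ) (z : ℂ) :
    refState N ᵥ* opB q η z = 0 := by
  rw [opB, monodromy_eq_chain]
  exact (refState_vecMul_chain q η z (List.nodup_reverse.2 (List.nodup_finRange N))).1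

theorem opC_mulVec_refState {N : ℕ} (q : ℂ) (η : Fin N → ℂ) (z : ℂ) :
    opC q η z *ᵥ refState N = 0 := by
  rw [opC, monodromy_eq_chain]
  exact (chain_mulVec_refState q η z (List.nodup_reverse.2 (List.nodup_finRange N))).1

theorem refState_vecMul_opD {N : ℕ} (q : ℂ) {η : Fin N → ℂ} (hη : ∀ a, η a ≠ 0) (a : Fin N) :
    refState N ᵥ* opD q η (η a) = 0 := by
  rw [opD, monodromy_eq_chain,
    (refState_vecMul_chain q η (η a) (List.nodup_reverse.2 (List.nodup_finRange N))).2,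
    List.prod_eq_zero, zero_smul]
  exact List.mem_map.2 ⟨a, by simp, by simp [hη a]⟩

theorem opD_mulVec_refState {N : ℕ} (q : ℂ) {η : Fin N → ℂ} (hη : ∀ a, η a ≠ 0) (a : Fin N) :
    opD q η (η a) *ᵥ refState N = 0 := by
  rw [opD, monodromy_eq_chain,
    (chain_mulVec_refState q η (η a) (List.nodup_reverse.2 (List.nodup_finRange N))).2,
    List.prod_eq_zero, zero_smul]
  exact List.mem_map.2 ⟨a, by simp, by simp [hη a]⟩

/-! ### Generic inhomogeneities -/

/-- The genericity conditions on the inhomogeneities under which separation of variables holds. -/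
structure Generic {N : ℕ} (q : ℂ) (η : Fin N → ℂ) : Prop where
  hq : q ≠ 0
  hq2 : q ^ 2 ≠ 1
  hη : ∀ a, η a ≠ 0
  sep : ∀ a b, a ≠ b → η a ^ 2 ≠ η b ^ 2
  sepq : ∀ a b, η a ^ 2 ≠ q ^ 2 * η b ^ 2

theorem generic_of_lt {N : ℕ} {q : ℂ} (hq : q ≠ 0) (hq2 : q ^ 2 ≠ 1) {η : Fin N → ℂ}
    (hη : ∀ a, η a ≠ 0)
    (hsov : ∀ a b : Fin N, a < b → ∀ j ∈ ({-1, 0, 1} : Set ℤ), η a ^ 2 ≠ q ^ (2 * j) * η b ^ 2) :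
    Generic q η := by
  have h0 : ∀ a b, a < b → η a ^ 2 ≠ η b ^ 2 := fun a b h => by simpa using hsov a b h 0 (by simp)
  have h1 : ∀ a b, a < b → η a ^ 2 ≠ q ^ 2 * η b ^ 2 := fun a b h => by
    simpa using hsov a b h 1 (by simp)
  -- The value `j = -1` gives the condition with the two sites exchanged.
  have h2 : ∀ a b, a < b → η b ^ 2 ≠ q ^ 2 * η a ^ 2 := fun a b h h' => by
    refine hsov a b h (-1) (by simp) ?_
    rw [h', show (2 * (-1) : ℤ) = -((2 : ℕ) : ℤ) by norm_num, zpow_neg, zpow_natCast]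
    field_simp
  refine ⟨hq, hq2, hη, fun a b h => ?_, fun a b => ?_⟩
  · rcases lt_or_gt_of_ne h with h | h
    · exact h0 a b h
    · exact (h0 b a h).symm
  · rcases lt_trichotomy a b with h | h | h
    · exact h1 a b h
    · subst h
      intro h'
      apply hq2
      have := pow_ne_zero 2 (hη a)
      exact mul_right_cancel₀ this (by rw [one_mul, ← h'])
    · exact h2 b a h

section Generic

variable {N : ℕ} {q : ℂ} {η : Fin N → ℂ}

theorem Generic.div_sub_inv_ne_zero (G : Generic q η) {a b : Fin N} (h : a ≠ b) :
    η a / η b - (η a / η b)⁻¹ ≠ 0 := by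
  have ha := G.hη a
  have hb := G.hη b
  intro h'
  field_simp at h'
  exact G.sep a b h (by linear_combination h')

theorem Generic.mul_sub_inv_ne_zero (G : Generic q η) (a b : Fin N) :
    η a / η b * q - (q * (η a / η b))⁻¹ ≠ 0 := by
  have ha := G.hη a
  have hb := G.hη b
  have hq := G.hq
  intro h'
  field_simp at h'
  exact G.sepq b a (by linear_combination -h')

theorem Generic.aFun_ne_zero (G : Generic q η) (a : Fin N) : aFun q η (η a) ≠ 0 := by
  refine neg_ne_zero.2 (Finset.prod_ne_zero_iff.2 fun n _ h' => ?_)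
  have ha := G.hη a
  have hb := G.hη n
  have hq := G.hq
  field_simp at h'
  exact G.sepq n a (by linear_combination -h')

theorem Generic.dFun_ne_zero (G : Generic q η) (a : Fin N) : dFun η (η a / q) ≠ 0 := by
  refine Finset.prod_ne_zero_iff.2 fun n _ h' => ?_
  have ha := G.hη a
  have hb := G.hη n
  have hq := G.hq
  field_simp at h'
  exact G.sepq a n (by linear_combination h')

/-- Each basis carries one factor `normN⁻¹`, so only the square enters the pairings and the branch
of the roots is immaterial. -/
theorem normN_sq (η : Fin N → ℂ) :
    normN η ^ 2 = ∏ a, ∏ b ∈ Finset.Iio a, (η a / η b - η b / η a) := by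
  rw [normN, ← Finset.prod_pow]
  refine Finset.prod_congr rfl fun a _ => ?_
  rw [← Finset.prod_pow]
  refine Finset.prod_congr rfl fun b _ => ?_
  rw [← Complex.cpow_nat_mul]
  norm_num

theorem Generic.normN_ne_zero (G : Generic q η) : normN η ≠ 0 := by
  refine fun h => ?_
  have := normN_sq η
  rw [h, zero_pow two_ne_zero, eq_comm, Finset.prod_eq_zero_iff] at this
  obtain ⟨a, -, ha⟩ := this
  rw [Finset.prod_eq_zero_iff] at ha
  obtain ⟨b, hb, hab⟩ := ha
  refine G.div_sub_inv_ne_zero (Finset.mem_Iio.1 hb).ne' ?_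
  rwa [inv_div]

end Generic

/-! ### The bases of separation of variables and their pairings -/

theorem list_prod_pow_update {M : Type*} [Monoid M] {N : ℕ} (g : Fin N → M)
    (hg : ∀ a b, Commute (g a) (g b)) (h : Fin N → Fin 2) {a : Fin N} (ha : h a = 0) :
    (List.ofFn fun n => g n ^ (Function.update h a 1 n : ℕ)).prod =
      (List.ofFn fun n => g n ^ (h n : ℕ)).prod * g a := by
  rw [List.ofFn_eq_map, List.ofFn_eq_map]
  have key : ∀ l : List (Fin N), l.Nodup → (l.map fun n => g n ^ (Function.update h a 1 n : ℕ)).prod =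
      (l.map fun n => g n ^ (h n : ℕ)).prod * (if a ∈ l then g a else 1) := by
    intro l hl
    induction l with
    | nil => simp
    | cons m l ih =>
      rw [List.nodup_cons] at hl
      rw [List.map_cons, List.prod_cons, ih hl.2, List.map_cons, List.prod_cons]
      by_cases hm : m = a
      · subst hm
        have : Commute (g m) (l.map fun n => g n ^ (h n : ℕ)).prod := by
          refine Commute.list_prod_right _ _ fun x hx => ?_
          obtain ⟨n, -, rfl⟩ := List.mem_map.1 hx
          exact (hg m n).pow_right _
        simp [hl.1, ha, this.eq]
      · rw [Function.update_of_ne hm]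
        simp [Ne.symm hm, mul_assoc]
  simpa using key _ (List.nodup_finRange N)

theorem eq_zero_of_ne_one {i : Fin 2} (h : i ≠ 1) : i = 0 := by
  omega

/-- Every configuration arises from `0` by raising sites one at a time, so properties of the bases
propagate from the reference state. -/
theorem conf_induction {N : ℕ} {P : Conf N → Prop} (h0 : P 0)
    (hs : ∀ h a, h a = 0 → P h → P (Function.update h a 1)) (h : Conf N) : P h := by
  have key : ∀ s : Finset (Fin N), P fun n => if n ∈ s then 1 else 0 := by
    intro s
    induction s using Finset.induction_on with
    | empty =>
      convert h0 using 1
      ext n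
      simp
    | insert a s ha ih =>
      convert hs _ a (by simp [ha]) ih using 1
      ext n
      by_cases hn : n = a
      · subst hn; simp
      · simp [hn]
  convert key (Finset.univ.filter fun n => h n = 1) using 1
  ext n
  by_cases hn : h n = 1
  · simp [hn]
  · simp [eq_zero_of_ne_one hn]

section SOV

variable {N : ℕ} {q : ℂ} {η : Fin N → ℂ}

theorem leftSOV_zero : leftSOV q η 0 = (normN η)⁻¹ • refState N := by
  simp [leftSOV]

theorem rightSOV_zero : rightSOV q η 0 = (normN η)⁻¹ • refState N := by
  simp [rightSOV]

theorem Generic.leftSOV_vecMul_opC (G : Generic q η) {h : Conf N} {a : Fin N} (ha : h a = 0) :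
    leftSOV q η h ᵥ* opC q η (η a) = dFun η (η a / q) • leftSOV q η (Function.update h a 1) := by
  rw [leftSOV, leftSOV, list_prod_pow_update _ _ h ha, ← Matrix.vecMul_vecMul, Matrix.vecMul_smul,
    Matrix.smul_vecMul, smul_comm _ (normN η)⁻¹, smul_smul (dFun _ _),
    mul_inv_cancel₀ (G.dFun_ne_zero a), one_smul]
  intro a b
  refine Commute.smul_left (Commute.smul_right ?_ _) _
  exact opC_mul_opC G.hq G.hη (G.hη a) (G.hη b) (G.mul_sub_inv_ne_zero a b)

theorem Generic.opB_mulVec_rightSOV (G : Generic q η) {h : Conf N} {a : Fin N} (ha : h a = 0) :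
    opB q η (η a) *ᵥ rightSOV q η h = aFun q η (η a) • rightSOV q η (Function.update h a 1) := by
  have hc : ∀ a b, Commute ((aFun q η (η a))⁻¹ • opB q η (η a))
      ((aFun q η (η b))⁻¹ • opB q η (η b)) := by
    intro a b
    refine Commute.smul_left (Commute.smul_right ?_ _) _
    exact opB_mul_opB G.hq G.hη (G.hη a) (G.hη b) (G.mul_sub_inv_ne_zero a b)
  have hc' : Commute (List.ofFn fun n => ((aFun q η (η n))⁻¹ • opB q η (η n)) ^ (h n : ℕ)).prod
      ((aFun q η (η a))⁻¹ • opB q η (η a)) := by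
    refine Commute.list_prod_left _ _ fun x hx => ?_
    obtain ⟨n, rfl⟩ := (List.mem_ofFn' _ _).1 hx
    exact (hc n a).pow_left _
  rw [rightSOV, rightSOV, list_prod_pow_update _ hc h ha, hc'.eq, ← Matrix.mulVec_mulVec,
    Matrix.smul_mulVec, Matrix.mulVec_smul, smul_comm _ (normN η)⁻¹, smul_smul (aFun _ _ _),
    mul_inv_cancel₀ (G.aFun_ne_zero a), one_smul]

/-- In the exchange relation of `D(η_a)` and `C(η_b)` applied to `⟨h|` with `h_a = h_b = 0`, the
terms starting with `D` vanish by induction; what remains is `⟨h| C(η_b) D(η_a)`, with a nonzero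
factor. -/
theorem Generic.leftSOV_vecMul_opD (G : Generic q η) (h : Conf N) :
    ∀ a, h a = 0 → leftSOV q η h ᵥ* opD q η (η a) = 0 := by
  induction h using conf_induction with
  | h0 =>
    intro a _
    rw [leftSOV_zero, Matrix.smul_vecMul, refState_vecMul_opD q G.hη, smul_zero]
  | hs h b hb ih =>
    intro a ha
    have hab : a ≠ b := by rintro rfl; simp at ha
    rw [Function.update_of_ne hab] at ha
    have := congrArg (leftSOV q η h ᵥ* ·) (opC_mul_opD G.hq G.hη (G.hη a) (G.hη b))
    simp only [Matrix.vecMul_add, Matrix.vecMul_smul, ← Matrix.vecMul_vecMul, ih a ha, ih b hb,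
      G.leftSOV_vecMul_opC hb, Matrix.zero_vecMul, smul_zero, add_zero, Matrix.smul_vecMul] at this
    simpa [G.div_sub_inv_ne_zero hab, G.dFun_ne_zero b, -inv_div] using this.symm

theorem Generic.leftSOV_vecMul_opB (G : Generic q η) (h : Conf N) :
    ∀ a, h a = 0 → leftSOV q η h ᵥ* opB q η (η a) = 0 := by
  induction h using conf_induction with
  | h0 =>
    intro a _
    rw [leftSOV_zero, Matrix.smul_vecMul, refState_vecMul_opB, smul_zero]
  | hs h b hb ih =>
    intro a ha
    have hab : a ≠ b := by rintro rfl; simp at ha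
    rw [Function.update_of_ne hab] at ha
    have := congrArg (leftSOV q η h ᵥ* ·) (opC_mul_opB_of_left G.hq G.hη (G.hη a) (G.hη b))
    simp only [Matrix.vecMul_add, Matrix.vecMul_smul, ← Matrix.vecMul_vecMul, ih a ha,
      G.leftSOV_vecMul_opD h a ha, G.leftSOV_vecMul_opD h b hb,
      G.leftSOV_vecMul_opC hb, Matrix.zero_vecMul, smul_zero, add_zero, Matrix.smul_vecMul] at this
    simpa [G.div_sub_inv_ne_zero hab, G.dFun_ne_zero b, -inv_div] using this.symm

theorem Generic.opD_mulVec_rightSOV (G : Generic q η) (h : Conf N) :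
    ∀ a, h a = 0 → opD q η (η a) *ᵥ rightSOV q η h = 0 := by
  induction h using conf_induction with
  | h0 =>
    intro a _
    rw [rightSOV_zero, Matrix.mulVec_smul, opD_mulVec_refState q G.hη, smul_zero]
  | hs h b hb ih =>
    intro a ha
    have hab : a ≠ b := by rintro rfl; simp at ha
    rw [Function.update_of_ne hab] at ha
    have := congrArg (· *ᵥ rightSOV q η h) (opD_mul_opB G.hq G.hη (G.hη a) (G.hη b))
    simp only [Matrix.add_mulVec, Matrix.smul_mulVec, ← Matrix.mulVec_mulVec, ih a ha, ih b hb,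
      G.opB_mulVec_rightSOV hb, Matrix.mulVec_zero, smul_zero, add_zero, Matrix.mulVec_smul] at this
    simpa [G.div_sub_inv_ne_zero hab, G.aFun_ne_zero b, -inv_div] using this

theorem Generic.opC_mulVec_rightSOV (G : Generic q η) (h : Conf N) :
    ∀ a, h a = 0 → opC q η (η a) *ᵥ rightSOV q η h = 0 := by
  induction h using conf_induction with
  | h0 =>
    intro a _
    rw [rightSOV_zero, Matrix.mulVec_smul, opC_mulVec_refState, smul_zero]
  | hs h b hb ih =>
    intro a ha
    have hab : a ≠ b := by rintro rfl; simp at ha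
    rw [Function.update_of_ne hab] at ha
    have := congrArg (· *ᵥ rightSOV q η h) (opC_mul_opB_of_right G.hq G.hη (G.hη a) (G.hη b))
    simp only [Matrix.add_mulVec, Matrix.smul_mulVec, ← Matrix.mulVec_mulVec, ih a ha,
      G.opD_mulVec_rightSOV h a ha, G.opD_mulVec_rightSOV h b hb,
      G.opB_mulVec_rightSOV hb, Matrix.mulVec_zero, smul_zero, add_zero, Matrix.mulVec_smul] at this
    simpa [G.div_sub_inv_ne_zero hab, G.aFun_ne_zero b, -inv_div] using this

theorem update_update_self_of_eq {h : Conf N} {a : Fin N} {c : Fin 2} (ha : h a = c) (d : Fin 2) :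
    Function.update (Function.update h a d) a c = h := by
  rw [Function.update_idem, ← ha, Function.update_eq_self]

/-- The pairings of the left and right bases of separation of variables. -/
def gram (q : ℂ) (η : Fin N → ℂ) (h k : Conf N) : ℂ := leftSOV q η h ⬝ᵥ rightSOV q η k

/-- The state with a `1` at `a` is the image under `B(η_a)` or `C(η_a)` of one with a `0`, and that
operator annihilates the other state. -/
theorem Generic.gram_of_apply_ne (G : Generic q η) {h k : Conf N} {a : Fin N} (hk : h a ≠ k a) :
    gram q η h k = 0 := by
  by_cases ha : h a = 0
  · have ka : k a = 1 := Fin.eq_one_of_ne_zero _ fun h' => hk (ha.trans h'.symm)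
    have h1 := G.opB_mulVec_rightSOV (h := Function.update k a 0) (a := a) (by simp)
    rw [update_update_self_of_eq ka] at h1
    have h2 := congrArg (leftSOV q η h ⬝ᵥ ·) h1
    simp only [Matrix.dotProduct_mulVec, G.leftSOV_vecMul_opB h a ha, zero_dotProduct,
      dotProduct_smul] at h2
    simpa [G.aFun_ne_zero a, gram] using h2.symm
  · have ha : h a = 1 := Fin.eq_one_of_ne_zero _ ha
    have ka : k a = 0 := eq_zero_of_ne_one fun h' => hk (ha.trans h'.symm)
    have h1 := G.leftSOV_vecMul_opC (h := Function.update h a 0) (a := a) (by simp)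
    rw [update_update_self_of_eq ha] at h1
    have h2 := congrArg (· ⬝ᵥ rightSOV q η k) h1
    simp only [← Matrix.dotProduct_mulVec, G.opC_mulVec_rightSOV k a ka, dotProduct_zero,
      smul_dotProduct] at h2
    simpa [G.dFun_ne_zero a, gram] using h2.symm

/-- The node `η_a q^{-h_a}`. -/
def node (q : ℂ) (η : Fin N → ℂ) (h : Conf N) (a : Fin N) : ℂ := η a / q ^ (h a : ℕ)

theorem node_of_eq_zero {h : Conf N} {a : Fin N} (ha : h a = 0) : node q η h a = η a := by
  simp [node, ha]

theorem node_of_eq_one {h : Conf N} {a : Fin N} (ha : h a = 1) : node q η h a = η a / q := by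
  simp [node, ha]

theorem Generic.node_ne_zero (G : Generic q η) (h : Conf N) (a : Fin N) : node q η h a ≠ 0 :=
  div_ne_zero (G.hη a) (pow_ne_zero _ G.hq)

theorem Generic.node_sq_injective (G : Generic q η) (h : Conf N) :
    Function.Injective fun a => node q η h a ^ 2 := by
  intro a b hab
  by_contra hne
  have hq := G.hq
  dsimp only at hab
  by_cases ha : h a = 0 <;> by_cases hb : h b = 0
  · rw [node_of_eq_zero ha, node_of_eq_zero hb] at hab
    exact G.sep a b hne hab
  · rw [node_of_eq_zero ha, node_of_eq_one (Fin.eq_one_of_ne_zero _ hb)] at hab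
    field_simp at hab
    exact G.sepq b a (by rw [← hab, mul_comm])
  · rw [node_of_eq_one (Fin.eq_one_of_ne_zero _ ha), node_of_eq_zero hb] at hab
    field_simp at hab
    exact G.sepq a b hab
  · rw [node_of_eq_one (Fin.eq_one_of_ne_zero _ ha), node_of_eq_one (Fin.eq_one_of_ne_zero _ hb)]
      at hab
    field_simp at hab
    exact G.sep a b hne hab

/-- By the quantum determinant `C(η_a / q) B(η_a)` is a scalar plus a term ending in `D(η_a)`, which
vanishes when site `a` is not raised. -/
theorem Generic.opC_node_mulVec_rightSOV (G : Generic q η) {k : Conf N} {a : Fin N}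
    (ka : k a = 1) : opC q η (η a / q) *ᵥ rightSOV q η k =
      dFun η (η a / q) • rightSOV q η (Function.update k a 0) := by
  have h1 := G.opB_mulVec_rightSOV (h := Function.update k a 0) (a := a) (by simp)
  rw [update_update_self_of_eq ka] at h1
  have h2 := congrArg (opC q η (η a / q) *ᵥ ·) h1
  simp only [Matrix.mulVec_mulVec, Matrix.mulVec_smul, quantum_det' G.hq G.hq2 G.hη (G.hη a),
    Matrix.add_mulVec] at h2
  rw [← Matrix.mulVec_mulVec, G.opD_mulVec_rightSOV _ a (by simp), Matrix.mulVec_zero, zero_add,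
    Matrix.smul_mulVec, Matrix.one_mulVec, mul_smul] at h2
  exact (smul_right_injective _ (G.aFun_ne_zero a) h2).symm

/-- Stated against the right family because its completeness is deduced later from the norms. For
`k_a = 0`, a factor `C(η_a)` extracted from `⟨h|` is commuted through to annihilate `|k⟩`. -/
theorem Generic.opC_node_element (G : Generic q η) {h : Conf N} {a : Fin N} (ha : h a = 1)
    (k : Conf N) : leftSOV q η h ⬝ᵥ (opC q η (η a / q) *ᵥ rightSOV q η k) = 0 := by
  by_cases ka : k a = 1
  · rw [G.opC_node_mulVec_rightSOV ka, dotProduct_smul]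
    have := G.gram_of_apply_ne (h := h) (k := Function.update k a 0) (a := a) (by simp [ha])
    rw [gram] at this
    rw [this, smul_zero]
  · have ka := eq_zero_of_ne_one ka
    have h1 := G.leftSOV_vecMul_opC (h := Function.update h a 0) (a := a) (by simp)
    rw [update_update_self_of_eq ha] at h1
    have h2 := congrArg (· ⬝ᵥ (opC q η (η a / q) *ᵥ rightSOV q η k)) h1
    simp only [← Matrix.dotProduct_mulVec, Matrix.mulVec_mulVec, smul_dotProduct] at h2
    rw [opC_commute G.hq G.hη (G.hη a) (div_ne_zero (G.hη a) G.hq), ← Matrix.mulVec_mulVec,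
      G.opC_mulVec_rightSOV k a ka, Matrix.mulVec_zero, dotProduct_zero] at h2
    simpa [G.dFun_ne_zero a] using h2.symm

/-- Interpolation is done at nodes adapted to `h`: there `C` raises site `a` if `h_a = 0` and gives
zero if `h_a = 1`. -/
theorem Generic.opC_element (G : Generic q η) (hN : 0 < N) {z : ℂ} (hz : z ≠ 0) (h k : Conf N) :
    z ^ (N - 1) * (leftSOV q η h ⬝ᵥ (opC q η z *ᵥ rightSOV q η k)) =
      ∑ a, if h a = 0 then η a ^ (N - 1) * (dFun η (η a / q) * gram q η (Function.update h a 1) k) *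
        ∏ b ∈ Finset.univ.erase a, (z ^ 2 - node q η h b ^ 2) / (η a ^ 2 - node q η h b ^ 2)
        else 0 := by
  have hF : LaurentBound (N - 1) fun z => leftSOV q η h ⬝ᵥ (opC q η z *ᵥ rightSOV q η k) := by
    simp only [dotProduct, Matrix.mulVec]
    refine LaurentBound.sum _ fun s => ?_
    have : LaurentBound (N - 1) fun z => ∑ s', opC q η z s s' * rightSOV q η k s' :=
      LaurentBound.sum _ fun s' => (opBound_opC G.hq G.hη s s').mul (LaurentBound.const _)
    simpa using (LaurentBound.const _).mul this
  rw [hF.interpolate hN (G.node_ne_zero h) (G.node_sq_injective h) hz]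
  refine Finset.sum_congr rfl fun a _ => ?_
  split_ifs with ha
  · rw [node_of_eq_zero ha, Matrix.dotProduct_mulVec, G.leftSOV_vecMul_opC ha, smul_dotProduct,
      smul_eq_mul, gram]
  · rw [node_of_eq_one (Fin.eq_one_of_ne_zero _ ha),
      G.opC_node_element (Fin.eq_one_of_ne_zero _ ha), mul_zero, zero_mul]

/-- The Vandermonde product `∏_{b < a} (y_a - y_b)`. -/
def vand (y : Fin N → ℂ) : ℂ := ∏ a, ∏ b ∈ Finset.Iio a, (y a - y b)

theorem vand_update (y : Fin N → ℂ) (a : Fin N) (z : ℂ) :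
    vand (Function.update y a z) * ∏ b ∈ Finset.univ.erase a, (y a - y b) =
      vand y * ∏ b ∈ Finset.univ.erase a, (z - y b) := by
  have key : ∃ c, ∀ w, vand (Function.update y a w) =
      c * ∏ b ∈ Finset.univ.erase a, (w - y b) := by
    -- As a function of the entry at `a`, the Vandermonde product is a constant times `∏ (w - y b)`;
    -- each index above `a` contributes a sign.
    refine ⟨(∏ i ∈ Finset.univ.erase a, ∏ j ∈ (Finset.Iio i).erase a, (y i - y j)) *
      ∏ i ∈ Finset.Ioi a, (-1), fun w => ?_⟩
    have h1 : ∀ i ∈ Finset.univ.erase a, ∏ j ∈ Finset.Iio i,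
        (Function.update y a w i - Function.update y a w j) =
        (∏ j ∈ (Finset.Iio i).erase a, (y i - y j)) * if a < i then y i - w else 1 := by
      intro i hi
      have hi := Finset.ne_of_mem_erase hi
      split_ifs with hai
      · rw [← Finset.prod_erase_mul _ _ (Finset.mem_Iio.2 hai)]
        congr 1
        · refine Finset.prod_congr rfl fun j hj => ?_
          rw [Function.update_of_ne hi, Function.update_of_ne (Finset.ne_of_mem_erase hj)]
        · rw [Function.update_of_ne hi, Function.update_self]
      · rw [Finset.erase_eq_of_notMem (by simpa using hai), mul_one]
        refine Finset.prod_congr rfl fun j hj => ?_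
        rw [Function.update_of_ne hi, Function.update_of_ne]
        rintro rfl
        exact hai (Finset.mem_Iio.1 hj)
    have h2 : ∏ j ∈ Finset.Iio a, (Function.update y a w a - Function.update y a w j) =
        ∏ j ∈ Finset.Iio a, (w - y j) := by
      refine Finset.prod_congr rfl fun j hj => ?_
      rw [Function.update_self, Function.update_of_ne (Finset.mem_Iio.1 hj).ne]
    have h3 : (Finset.univ.erase a : Finset (Fin N)) = Finset.Iio a ∪ Finset.Ioi a := by
      ext b
      simp only [Finset.mem_erase, Finset.mem_univ, and_true, Finset.mem_union, Finset.mem_Iio,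
        Finset.mem_Ioi]
      exact ne_iff_lt_or_gt
    have h4 : Disjoint (Finset.Iio a) (Finset.Ioi a) := by
      rw [Finset.disjoint_left]
      intro b hb hb'
      exact lt_asymm (Finset.mem_Iio.1 hb) (Finset.mem_Ioi.1 hb')
    rw [vand, ← Finset.prod_erase_mul _ _ (Finset.mem_univ a), Finset.prod_congr rfl h1, h2,
      Finset.prod_mul_distrib, mul_assoc, mul_assoc]
    congr 1
    rw [h3, Finset.prod_union h4, Finset.prod_union h4, Finset.prod_eq_one (s := Finset.Iio a),
      one_mul, mul_left_comm, mul_comm]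
    · congr 1
      rw [← Finset.prod_mul_distrib]
      refine Finset.prod_congr rfl fun j hj => ?_
      rw [if_pos (Finset.mem_Ioi.1 hj)]
      ring
    · intro j hj
      rw [if_neg (Finset.mem_Iio.1 hj).asymm]
  obtain ⟨c, hc⟩ := key
  have := hc (y a)
  rw [Function.update_eq_self] at this
  rw [hc, this]
  ring

theorem prod_Iio_mul (y : Fin N → ℂ) :
    ∏ a, ∏ b ∈ Finset.Iio a, (y a * y b) = ∏ a, y a ^ (N - 1) := by
  have h : ∏ a, ∏ b ∈ Finset.Iio a, y b = ∏ b, ∏ a ∈ Finset.Ioi b, y b :=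
    Finset.prod_comm' (by simp)
  simp only [Finset.prod_mul_distrib]
  rw [h, ← Finset.prod_mul_distrib]
  refine Finset.prod_congr rfl fun a _ => ?_
  rw [Finset.prod_const, Finset.prod_const, ← pow_add, Fin.card_Iio, Fin.card_Ioi]
  congr 1
  omega

/-- Raising one site changes the norm by an interpolation factor, which is the ratio of the two
Vandermonde products. -/
theorem Generic.gram_self (G : Generic q η) (hN : 0 < N) (h : Conf N) :
    gram q η h h * vand (fun a => node q η h a ^ 2) = ∏ a, node q η h a ^ (N - 1) := by
  induction h using conf_induction with
  | h0 =>
    have h1 : gram q η 0 0 * normN η ^ 2 = 1 := by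
      have := G.normN_ne_zero
      rw [gram, leftSOV_zero, rightSOV_zero, smul_dotProduct, dotProduct_smul, refState,
        single_dotProduct, Pi.single_eq_same]
      simp
      field_simp
    have h2 : vand (fun a => node q η 0 a ^ 2) = normN η ^ 2 * ∏ a, η a ^ (N - 1) := by
      rw [normN_sq η, ← prod_Iio_mul, ← Finset.prod_mul_distrib, vand]
      refine Finset.prod_congr rfl fun a _ => ?_
      rw [← Finset.prod_mul_distrib]
      refine Finset.prod_congr rfl fun b _ => ?_
      have ha := G.hη a
      have hb := G.hη b
      rw [node_of_eq_zero rfl, node_of_eq_zero rfl]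
      field_simp
    rw [h2, ← mul_assoc, h1, one_mul]
    exact Finset.prod_congr rfl fun a _ => by rw [node_of_eq_zero rfl]
  | hs h a ha ih =>
    set k := Function.update h a 1 with hk
    have ka : k a = 1 := by simp [hk]
    have hnode : node q η k = Function.update (node q η h) a (η a / q) := by
      ext b
      by_cases hb : b = a
      · subst hb
        rw [node_of_eq_one ka, Function.update_self]
      · rw [Function.update_of_ne hb, node, node, hk, Function.update_of_ne hb]
    have hnode2 : (fun b => node q η k b ^ 2) =
        Function.update (fun b => node q η h b ^ 2) a ((η a / q) ^ 2) := by
      ext b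
      rw [hnode]
      by_cases hb : b = a
      · subst hb; simp
      · simp [hb]
    -- The element of `C(η_a / q)` between `⟨h|` and `|k⟩` is computed twice: lowering `|k⟩` gives
    -- the norm of `h`, while interpolation gives that of `k`, all other terms vanishing by
    -- orthogonality.
    have hr := G.opC_element hN (div_ne_zero (G.hη a) G.hq) h k
    rw [G.opC_node_mulVec_rightSOV ka, dotProduct_smul, hk, update_update_self_of_eq ha, ← hk,
      Finset.sum_eq_single a, if_pos ha, Finset.prod_div_distrib] at hr
    · have hv := vand_update (fun b => node q η h b ^ 2) a ((η a / q) ^ 2)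
      rw [← hnode2] at hv
      simp only [node_of_eq_zero ha] at hv
      have hP : ∏ b ∈ Finset.univ.erase a, (η a ^ 2 - node q η h b ^ 2) ≠ 0 := by
        refine Finset.prod_ne_zero_iff.2 fun b hb => sub_ne_zero.2 fun h' => ?_
        refine Finset.ne_of_mem_erase hb (G.node_sq_injective h ?_)
        simpa only [node_of_eq_zero ha] using h'.symm
      have hprod : (∏ b, node q η k b ^ (N - 1)) * η a ^ (N - 1) =
          (∏ b, node q η h b ^ (N - 1)) * (η a / q) ^ (N - 1) := by
        rw [← Finset.prod_erase_mul _ _ (Finset.mem_univ a),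
          ← Finset.prod_erase_mul _ (fun b => node q η h b ^ (N - 1)) (Finset.mem_univ a),
          node_of_eq_one ka, node_of_eq_zero ha,
          Finset.prod_congr (g := fun b => node q η h b ^ (N - 1)) rfl]
        · ring
        · intro b hb
          rw [hnode, Function.update_of_ne (Finset.ne_of_mem_erase hb)]
      have hd := G.dFun_ne_zero a
      have hηa := pow_ne_zero (N - 1) (G.hη a)
      rw [smul_eq_mul, show leftSOV q η h ⬝ᵥ rightSOV q η h = gram q η h h from rfl,
        ← mul_div_assoc, eq_div_iff hP] at hr
      refine mul_right_cancel₀ hηa (mul_right_cancel₀ hP (mul_right_cancel₀ hd ?_))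
      rw [hprod, ← ih]
      linear_combination (gram q η k k * η a ^ (N - 1) * dFun η (η a / q)) * hv -
        vand (fun a => node q η h a ^ 2) * hr
    · intro b _ hba
      split_ifs with hb
      · rw [G.gram_of_apply_ne (a := a), mul_zero, mul_zero, zero_mul]
        rw [Function.update_of_ne hba.symm, ha, ka]
        simp
      · rfl
    · simp

end SOV

/-! ### Completeness, factorized eigenstates and eigenvalues -/

section Completeness

variable {N : ℕ} {q : ℂ} {η : Fin N → ℂ}

theorem Generic.gram_self_ne_zero (G : Generic q η) (hN : 0 < N) (h : Conf N) :
    gram q η h h ≠ 0 := by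
  intro h0
  have := G.gram_self hN h
  rw [h0, zero_mul] at this
  exact Finset.prod_ne_zero_iff.2 (fun a _ => pow_ne_zero _ (G.node_ne_zero h a)) this.symm

theorem Generic.gram_of_ne (G : Generic q η) {h k : Conf N} (hk : h ≠ k) : gram q η h k = 0 := by
  obtain ⟨a, ha⟩ := Function.ne_iff.1 hk
  exact G.gram_of_apply_ne ha

theorem Generic.det_ne_zero (G : Generic q η) (hN : 0 < N) :
    (Matrix.of (leftSOV q η)).det ≠ 0 ∧ (Matrix.of (rightSOV q η))ᵀ.det ≠ 0 := by
  rw [← mul_ne_zero_iff, ← Matrix.det_mul]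
  have : Matrix.of (leftSOV q η) * (Matrix.of (rightSOV q η))ᵀ =
      Matrix.diagonal fun h => gram q η h h := by
    ext h k
    change gram q η h k = _
    by_cases hk : h = k
    · subst hk; simp
    · rw [G.gram_of_ne hk, Matrix.diagonal_apply_ne _ hk]
  rw [this, Matrix.det_diagonal]
  exact Finset.prod_ne_zero_iff.2 fun h _ => G.gram_self_ne_zero hN h

theorem Generic.left_ext (G : Generic q η) (hN : 0 < N) {u u' : State N}
    (h : ∀ k, u ⬝ᵥ rightSOV q η k = u' ⬝ᵥ rightSOV q η k) : u = u' :=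
  Matrix.vecMul_injective_of_isUnit
    ((Matrix.isUnit_iff_isUnit_det _).2 (isUnit_iff_ne_zero.2 (G.det_ne_zero hN).2)) (funext h)

theorem Generic.right_ext (G : Generic q η) (hN : 0 < N) {v v' : State N}
    (h : ∀ k, leftSOV q η k ⬝ᵥ v = leftSOV q η k ⬝ᵥ v') : v = v' :=
  Matrix.mulVec_injective_of_isUnit
    ((Matrix.isUnit_iff_isUnit_det _).2 (isUnit_iff_ne_zero.2 (G.det_ne_zero hN).1)) (funext h)

theorem omegaFun_eq (hN : 0 < N) (z : ℂ) : omegaFun N z = z ^ (N - 1) := by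
  rw [omegaFun, ← zpow_natCast]
  congr 1
  omega

theorem sepCoeff_eq (Q : ℂ → ℂ) (h : Conf N) : sepCoeff q η Q h =
    (∏ a, Q (node q η h a) / omegaFun N (node q η h a)) * vand fun a => node q η h a ^ 2 := rfl

/-- The Vandermonde product and `ω` in the coefficients are there to cancel the norm. -/
theorem Generic.sepCoeff_mul_gram (G : Generic q η) (hN : 0 < N) (Q : ℂ → ℂ) (h : Conf N) :
    sepCoeff q η Q h * gram q η h h = ∏ a, Q (node q η h a) := by
  rw [sepCoeff_eq, mul_assoc, mul_comm (vand _), G.gram_self hN, ← Finset.prod_mul_distrib]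
  refine Finset.prod_congr rfl fun a _ => ?_
  rw [omegaFun_eq hN, div_mul_cancel₀ _ (pow_ne_zero _ (G.node_ne_zero h a))]

theorem Generic.leftState_dotProduct (G : Generic q η) (hN : 0 < N) (Q : ℂ → ℂ) (k : Conf N) :
    leftState q η Q ⬝ᵥ rightSOV q η k = ∏ a, Q (node q η k a) := by
  rw [leftState, sum_dotProduct, Finset.sum_eq_single k, smul_dotProduct, smul_eq_mul,
    ← G.sepCoeff_mul_gram hN, gram]
  · intro h _ hk
    have := G.gram_of_ne hk
    rw [gram] at this
    rw [smul_dotProduct, this, smul_zero]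
  · simp

theorem Generic.dotProduct_rightState (G : Generic q η) (hN : 0 < N) (Q : ℂ → ℂ) (h : Conf N) :
    leftSOV q η h ⬝ᵥ rightState q η Q = ∏ a, Q (node q η h a) := by
  rw [rightState, dotProduct_sum, Finset.sum_eq_single h, dotProduct_smul, smul_eq_mul,
    ← G.sepCoeff_mul_gram hN, gram]
  · intro k _ hk
    have := G.gram_of_ne hk.symm
    rw [gram] at this
    rw [dotProduct_smul, this, smul_zero]
  · simp

/-- At `η_a`, only `B` survives on `|h⟩` when `h_a = 0`, and it raises site `a`; the eigenvalue
equation becomes a recursion. -/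
theorem Generic.left_coeff_update (G : Generic q η) {t : ℂ → ℂ} {u : State N}
    (hu : IsLeftEigenstate q η t u) {h : Conf N} {a : Fin N} (ha : h a = 0) :
    u ⬝ᵥ rightSOV q η (Function.update h a 1) =
      t (η a) / aFun q η (η a) * (u ⬝ᵥ rightSOV q η h) := by
  have h1 := congrArg (· ⬝ᵥ rightSOV q η h) (hu.2 (η a) (G.hη a))
  simp only [← Matrix.dotProduct_mulVec, transfer, Matrix.add_mulVec, G.opB_mulVec_rightSOV ha,
    G.opC_mulVec_rightSOV h a ha, add_zero, dotProduct_smul, smul_dotProduct, smul_eq_mul] at h1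
  rw [div_mul_eq_mul_div, ← h1, mul_div_cancel_left₀ _ (G.aFun_ne_zero a)]

theorem Generic.right_coeff_update (G : Generic q η) {t : ℂ → ℂ} {v : State N}
    (hv : IsRightEigenstate q η t v) {h : Conf N} {a : Fin N} (ha : h a = 0) :
    leftSOV q η (Function.update h a 1) ⬝ᵥ v =
      t (η a) / dFun η (η a / q) * (leftSOV q η h ⬝ᵥ v) := by
  have h1 := congrArg (leftSOV q η h ⬝ᵥ ·) (hv.2 (η a) (G.hη a))
  simp only [Matrix.dotProduct_mulVec, transfer, Matrix.vecMul_add, G.leftSOV_vecMul_opC ha,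
    G.leftSOV_vecMul_opB h a ha, zero_add, dotProduct_smul, smul_dotProduct, smul_eq_mul] at h1
  rw [div_mul_eq_mul_div, ← h1, mul_div_cancel_left₀ _ (G.dFun_ne_zero a)]

open Classical in
/-- Coefficients with prescribed values on the two families of nodes. -/
def nodeFun (q : ℂ) (η : Fin N → ℂ) (γ : ℂ) (r : ℂ → ℂ) (z : ℂ) : ℂ :=
  if ∃ a, z = η a then γ else γ * r (z * q)

theorem nodeFun_self (γ : ℂ) (r : ℂ → ℂ) (a : Fin N) : nodeFun q η γ r (η a) = γ := by
  rw [nodeFun, if_pos ⟨a, rfl⟩]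

theorem Generic.nodeFun_div (G : Generic q η) (γ : ℂ) (r : ℂ → ℂ) (a : Fin N) :
    nodeFun q η γ r (η a / q) = γ * r (η a) := by
  have hq := G.hq
  rw [nodeFun, if_neg, div_mul_cancel₀ _ hq]
  rintro ⟨b, hb⟩
  apply G.sepq a b
  rw [← hb]
  field_simp

theorem Generic.eq_prod_nodeFun (G : Generic q η) {f : Conf N → ℂ} {r : ℂ → ℂ}
    (hf : ∀ h a, h a = 0 → f (Function.update h a 1) = r (η a) * f h) {γ : ℂ} (hγ : γ ^ N = f 0)
    (h : Conf N) : f h = ∏ a, nodeFun q η γ r (node q η h a) := by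
  induction h using conf_induction with
  | h0 =>
    rw [← hγ, Finset.prod_congr rfl fun a _ => (by
      rw [node_of_eq_zero rfl, nodeFun_self] : nodeFun q η γ r (node q η 0 a) = γ)]
    simp
  | hs h a ha ih =>
    rw [hf h a ha, ih, ← Finset.mul_prod_erase _ _ (Finset.mem_univ a),
      ← Finset.mul_prod_erase Finset.univ (fun b => nodeFun q η γ r (node q η _ b))
        (Finset.mem_univ a),
      node_of_eq_zero ha, node_of_eq_one (Function.update_self a 1 h), G.nodeFun_div, nodeFun_self,
      ← mul_assoc, mul_comm γ]
    congr 1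
    refine Finset.prod_congr rfl fun b hb => ?_
    rw [node, node, Function.update_of_ne (Finset.ne_of_mem_erase hb)]

theorem eq_zero_of_update {f : Conf N → ℂ} {r : Fin N → ℂ}
    (hf : ∀ h a, h a = 0 → f (Function.update h a 1) = r a * f h) (h0 : f 0 = 0) (h : Conf N) :
    f h = 0 := by
  induction h using conf_induction with
  | h0 => exact h0
  | hs h a ha ih => rw [hf h a ha, ih, mul_zero]

theorem Generic.left_coeff_zero_ne (G : Generic q η) (hN : 0 < N) {t : ℂ → ℂ} {u : State N}
    (hu : IsLeftEigenstate q η t u) : u ⬝ᵥ rightSOV q η 0 ≠ 0 := fun h0 =>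
  hu.1 (G.left_ext hN fun k => by
    rw [zero_dotProduct]
    exact eq_zero_of_update (f := fun k => u ⬝ᵥ rightSOV q η k)
      (fun h a ha => G.left_coeff_update hu ha) h0 k)

theorem Generic.right_coeff_zero_ne (G : Generic q η) (hN : 0 < N) {t : ℂ → ℂ} {v : State N}
    (hv : IsRightEigenstate q η t v) : leftSOV q η 0 ⬝ᵥ v ≠ 0 := fun h0 =>
  hv.1 (G.right_ext hN fun k => by
    rw [dotProduct_zero]
    exact eq_zero_of_update (f := fun k => leftSOV q η k ⬝ᵥ v)
      (fun h a ha => G.right_coeff_update hv ha) h0 k)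

theorem Generic.exists_leftQ (G : Generic q η) (hN : 0 < N) {t : ℂ → ℂ} {u : State N}
    (hu : IsLeftEigenstate q η t u) :
    ∃ Q : ℂ → ℂ, IsLeftQ q η t Q ∧ u = leftState q η Q := by
  -- All `Q(η_a)` are given the common value `γ`, so at `h = 0` the product over the sites is `γ ^
  -- N`; the root exists because `N > 0`.
  obtain ⟨γ, hγ⟩ := IsAlgClosed.exists_pow_nat_eq (u ⬝ᵥ rightSOV q η 0) hN
  have hγ0 : γ ≠ 0 := by
    rintro rfl
    rw [zero_pow hN.ne'] at hγ
    exact G.left_coeff_zero_ne hN hu hγ.symm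
  refine ⟨nodeFun q η γ fun z => t z / aFun q η z, fun a => ?_, G.left_ext hN fun k => ?_⟩
  · rw [nodeFun_self, G.nodeFun_div, mul_div_cancel_left₀ _ hγ0]
    exact ⟨hγ0, rfl⟩
  · rw [G.leftState_dotProduct hN]
    exact G.eq_prod_nodeFun (f := fun k => u ⬝ᵥ rightSOV q η k)
      (r := fun z => t z / aFun q η z) (fun h a ha => G.left_coeff_update hu ha) hγ k

theorem Generic.exists_rightQ (G : Generic q η) (hN : 0 < N) {t : ℂ → ℂ} {v : State N}
    (hv : IsRightEigenstate q η t v) :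
    ∃ Q : ℂ → ℂ, IsRightQ q η t Q ∧ v = rightState q η Q := by
  obtain ⟨γ, hγ⟩ := IsAlgClosed.exists_pow_nat_eq (leftSOV q η 0 ⬝ᵥ v) hN
  have hγ0 : γ ≠ 0 := by
    rintro rfl
    rw [zero_pow hN.ne'] at hγ
    exact G.right_coeff_zero_ne hN hv hγ.symm
  refine ⟨nodeFun q η γ fun z => t z / dFun η (z / q), fun a => ?_, G.right_ext hN fun k => ?_⟩
  · rw [nodeFun_self, G.nodeFun_div, mul_div_cancel_left₀ _ hγ0]
    exact ⟨hγ0, rfl⟩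
  · rw [G.dotProduct_rightState hN]
    exact G.eq_prod_nodeFun (f := fun k => leftSOV q η k ⬝ᵥ v)
      (r := fun z => t z / dFun η (z / q)) (fun h a ha => G.right_coeff_update hv ha) hγ k

/-- The matrix elements of `C(z)` between a covector of the basis and a separate state. -/
theorem Generic.opC_rightState (G : Generic q η) (hN : 0 < N) (Q : ℂ → ℂ) {z : ℂ} (hz : z ≠ 0)
    (h : Conf N) :
    z ^ (N - 1) * (leftSOV q η h ⬝ᵥ (opC q η z *ᵥ rightState q η Q)) =
      ∑ a, if h a = 0 then η a ^ (N - 1) * dFun η (η a / q) * Q (η a / q) *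
        ∏ b ∈ Finset.univ.erase a,
          (Q (node q η h b) * ((z ^ 2 - node q η h b ^ 2) / (η a ^ 2 - node q η h b ^ 2)))
        else 0 := by
  have e : leftSOV q η h ⬝ᵥ (opC q η z *ᵥ rightState q η Q) =
      ∑ k, sepCoeff q η Q k * (leftSOV q η h ⬝ᵥ (opC q η z *ᵥ rightSOV q η k)) := by
    simp only [rightState, Matrix.mulVec_sum, dotProduct_sum, Matrix.mulVec_smul, dotProduct_smul,
      smul_eq_mul]
  rw [e, Finset.mul_sum]
  simp only [mul_left_comm, G.opC_element hN hz, Finset.mul_sum]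
  rw [Finset.sum_comm]
  refine Finset.sum_congr rfl fun a _ => ?_
  split_ifs with ha
  · rw [Finset.sum_eq_single (Function.update h a 1)]
    · have h1 := G.sepCoeff_mul_gram hN Q (Function.update h a 1)
      rw [← Finset.mul_prod_erase _ _ (Finset.mem_univ a), node_of_eq_one (Function.update_self a 1 h),
        Finset.prod_congr (g := fun b => Q (node q η h b)) rfl] at h1
      · rw [Finset.prod_mul_distrib]
        linear_combination (η a ^ (N - 1) * dFun η (η a / q) * ∏ b ∈ Finset.univ.erase a,
          (z ^ 2 - node q η h b ^ 2) / (η a ^ 2 - node q η h b ^ 2)) * h1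
      · intro b hb
        rw [node, node, Function.update_of_ne (Finset.ne_of_mem_erase hb)]
    · intro k _ hk
      rw [G.gram_of_ne hk.symm]
      simp
    · simp
  · simp

/-- At the inhomogeneities the eigenvalues satisfy `t(η_a) t(η_a / q) = a(η_a) d(η_a / q)`. -/
theorem Generic.eigenvalue_mul (G : Generic q η) (hN : 0 < N) {t : ℂ → ℂ} {v : State N}
    (hv : IsRightEigenstate q η t v) (a : Fin N) :
    t (η a) * t (η a / q) = aFun q η (η a) * dFun η (η a / q) := by
  have hz := div_ne_zero (G.hη a) G.hq
  -- After `C(η_a)` site `a` is raised, and `C(η_a / q)` then gives zero. With `⟨0| B(η_a) = 0`,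
  -- only `C(η_a) B(η_a / q)` remains, a scalar on `⟨0|` by the quantum determinant.
  have hCC : leftSOV q η 0 ᵥ* (opC q η (η a) * opC q η (η a / q)) = 0 := by
    refine G.left_ext hN fun k => ?_
    rw [← Matrix.vecMul_vecMul, G.leftSOV_vecMul_opC rfl, Matrix.smul_vecMul, smul_dotProduct,
      ← Matrix.dotProduct_mulVec, G.opC_node_element (Function.update_self _ _ _), smul_zero,
      zero_dotProduct]
  have h1 : leftSOV q η 0 ᵥ* (transfer q η (η a) * transfer q η (η a / q)) =
      (aFun q η (η a) * dFun η (η a / q)) • leftSOV q η 0 := by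
    rw [transfer, transfer, add_mul, Matrix.vecMul_add, ← Matrix.vecMul_vecMul,
      G.leftSOV_vecMul_opB 0 a rfl, Matrix.zero_vecMul, zero_add, mul_add, Matrix.vecMul_add, hCC,
      add_zero, quantum_det G.hq G.hη (G.hη a), Matrix.vecMul_add, ← Matrix.vecMul_vecMul,
      G.leftSOV_vecMul_opD 0 a rfl, Matrix.zero_vecMul, zero_add, Matrix.vecMul_smul,
      Matrix.vecMul_one]
  have h2 := congrArg (· ⬝ᵥ v) h1
  simp only [← Matrix.dotProduct_mulVec, ← Matrix.mulVec_mulVec, hv.2 _ hz, hv.2 _ (G.hη a),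
    Matrix.mulVec_smul, dotProduct_smul, smul_dotProduct, smul_eq_mul] at h2
  refine mul_right_cancel₀ (G.right_coeff_zero_ne hN hv) ?_
  linear_combination h2

end Completeness

/-! ### Inverse problem: local operators from transfer matrices -/

section Reconstruction

theorem single_mul_laxEntry (q z : ℂ) (i j s r : Fin 2) :
    Matrix.single i j 1 * laxEntry q z s r =
      ∑ l, sixVertex q z s j r l • (Matrix.single i l 1 : Matrix (Fin 2) (Fin 2) ℂ) := by
  ext a b
  rw [Fin.sum_univ_two]
  fin_cases a <;> fin_cases b <;> fin_cases i <;>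
    simp [Matrix.mul_apply, Matrix.single_apply, laxEntry]

theorem laxEntry_mul_single (q z : ℂ) (p s j l : Fin 2) :
    laxEntry q z (p + 1) (s + 1) * Matrix.single (j + 1) l 1 =
      ∑ i, sixVertex q z p i s j • (Matrix.single (i + 1) l 1 : Matrix (Fin 2) (Fin 2) ℂ) := by
  ext a b
  rw [Fin.sum_univ_two, ← sixVertex_add_one, ← sixVertex_add_one q z p 1]
  fin_cases a <;> fin_cases b <;> fin_cases l <;>
    simp [Matrix.mul_apply, Matrix.single_apply, laxEntry]

/-- One of the two diagonal weights vanishes at `1` and the other equals the off-diagonal weight, so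
the Lax operator is a multiple of the permutation of site and auxiliary space. -/
theorem laxEntry_one (q : ℂ) (k m : Fin 2) :
    laxEntry q 1 k m = (q - q⁻¹) • (Matrix.single m k 1 : Matrix (Fin 2) (Fin 2) ℂ) := by
  ext a b
  fin_cases k <;> fin_cases m <;> fin_cases a <;> fin_cases b <;>
    simp [laxEntry, sixVertex]

variable {N : ℕ} {q : ℂ} {η : Fin N → ℂ}

theorem siteLax_self (hη : ∀ a, η a ≠ 0) (n : Fin N) (k m : Fin 2) :
    siteLax q η (n, false) (η n) k m = (q - q⁻¹) • localOp n (Matrix.single m k 1) := by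
  rw [siteLax, Matrix.of_apply, ← localOp_smul, ← laxEntry_one, div_self (hη n)]
  rfl

/-- Moving the last site to the front of the chain, with an exchange of the auxiliary states, is
implemented by the antiperiodic transfer matrix at the inhomogeneity of that site. -/
theorem chain_rotate (hq : q ≠ 0) (hη : ∀ a, η a ≠ 0) {n : Fin N} {l : List (Fin N × Bool)}
    (hl : (l.map Prod.fst).Nodup) (hn : n ∉ l.map Prod.fst) {z : ℂ} (hz : z ≠ 0) (p r : Fin 2) :
    chain q η ((n, true) :: l) z p r *
        (chain q η (l ++ [(n, false)]) (η n) 0 1 + chain q η (l ++ [(n, false)]) (η n) 1 0) =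
      (chain q η (l ++ [(n, false)]) (η n) 0 1 + chain q η (l ++ [(n, false)]) (η n) 1 0) *
        chain q η (l ++ [(n, false)]) z p r := by
  rw [chain_cons, chain_append_singleton, chain_append_singleton]
  set K := chain q η l z with hK
  set K' := chain q η l (η n) with hK'
  set E : Fin 2 → Fin 2 → Op N := fun i j => localOp n (Matrix.single i j 1) with hE
  have hx : ∀ i m, ∑ s, ∑ j, sixVertex q (z / η n) p i s j • (K s r * K' j m) =
      ∑ s, ∑ j, sixVertex q (z / η n) s j r m • (K' i j * K p s) := fun i m =>
    chain_exchangeRel hq hη hl hz (hη n) p i r m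
  have cK : ∀ X i j, localOp n X * K i j = K i j * localOp n X := fun X i j =>
    (localOp_commute_chain q η hn X z i j).eq
  have cK' : ∀ X i j, localOp n X * K' i j = K' i j * localOp n X := fun X i j =>
    (localOp_commute_chain q η hn X (η n) i j).eq
  -- At `η_n` the last site is a permutation, so `B + C` becomes a sum of matrix units at site `n`;
  -- the shift `i + 1` encodes the antiperiodic twist.
  have hS : (K' * siteLax q η (n, false) (η n)) 0 1 + (K' * siteLax q η (n, false) (η n)) 1 0 =
      (q - q⁻¹) • ∑ i, ∑ j, K' i j * E (i + 1) j := by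
    simp only [Matrix.mul_apply, siteLax_self hη, Fin.sum_univ_two, mul_smul_comm, smul_add, hE]
    rfl
  have sum_localOp : ∀ (f : Fin 2 → Matrix (Fin 2) (Fin 2) ℂ),
      localOp n (∑ i, f i) = ∑ i, localOp n (f i) := fun f => map_sum (localLin n) f _
  have h1 : ∀ i j s, (K' i j * E (i + 1) j) * (K p s * siteLax q η (n, false) z s r) =
      ∑ m, sixVertex q (z / η n) s j r m • (K' i j * K p s * E (i + 1) m) := by
    intro i j s
    rw [mul_assoc, ← mul_assoc (E (i + 1) j), hE, cK, mul_assoc, ← mul_assoc]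
    simp only [siteLax, Matrix.of_apply, cond_false, localOp_mul, single_mul_laxEntry, sum_localOp,
      localOp_smul, Finset.mul_sum, mul_smul_comm]
  have h2 : ∀ s j m, (siteLax q η (n, true) z p s * K s r) * (K' j m * E (j + 1) m) =
      ∑ i, sixVertex q (z / η n) p i s j • (K s r * K' j m * E (i + 1) m) := by
    intro s j m
    have : siteLax q η (n, true) z p s = localOp n (laxEntry q (z / η n) (p + 1) (s + 1)) := rfl
    rw [this, cK, mul_assoc, ← mul_assoc _ (K' j m), cK', mul_assoc, ← mul_assoc]
    simp only [hE, localOp_mul, laxEntry_mul_single, sum_localOp,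
      localOp_smul, Finset.mul_sum, mul_smul_comm]
  have h3 : (∑ i, ∑ j, K' i j * E (i + 1) j) * (K * siteLax q η (n, false) z) p r =
      ∑ i, ∑ m, (∑ s, ∑ j, sixVertex q (z / η n) s j r m • (K' i j * K p s)) * E (i + 1) m := by
    rw [Matrix.mul_apply]
    simp only [Finset.sum_mul, Finset.mul_sum, h1, smul_mul_assoc]
    simp only [Fin.sum_univ_two]
    abel
  have h4 : (siteLax q η (n, true) z * K) p r * (∑ i, ∑ j, K' i j * E (i + 1) j) =
      ∑ i, ∑ m, (∑ s, ∑ j, sixVertex q (z / η n) p i s j • (K s r * K' j m)) * E (i + 1) m := by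
    rw [Matrix.mul_apply]
    simp only [Finset.sum_mul, Finset.mul_sum, h2, smul_mul_assoc]
    simp only [Fin.sum_univ_two]
    abel
  -- Both sides are now expansions in the matrix units at site `n`, with coefficients the two sides
  -- of the exchange relation of the remaining chain.
  rw [hS, mul_smul_comm, smul_mul_assoc, h3, h4]
  simp only [hx]

/-- The last site is a matrix unit whose row is the auxiliary index `m`, so `σᶻ` acts by the sign
attached to `m`: plus on `C`, minus on `B`. -/
theorem pauliZ_mul_chain (hη : ∀ a, η a ≠ 0) {n : Fin N} {l : List (Fin N × Bool)}
    (hn : n ∉ l.map Prod.fst) (i m : Fin 2) :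
    localOp n pauliZ * chain q η (l ++ [(n, false)]) (η n) i m =
      pauliZ m m • chain q η (l ++ [(n, false)]) (η n) i m := by
  have hZ : ∀ k, pauliZ * Matrix.single m k 1 = pauliZ m m • Matrix.single m k 1 := by
    intro k
    ext a b
    fin_cases m <;> fin_cases a <;> fin_cases b <;>
      simp [pauliZ, Matrix.mul_apply, Matrix.single_apply]
  rw [chain_append_singleton, Matrix.mul_apply, Finset.mul_sum, Finset.smul_sum]
  refine Finset.sum_congr rfl fun k _ => ?_
  rw [← mul_assoc, (localOp_commute_chain q η hn pauliZ (η n) i k).eq, mul_assoc, siteLax_self hη,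
    mul_smul_comm, localOp_mul, hZ, localOp_smul]
  simp only [mul_smul_comm, smul_comm (q - q⁻¹)]

/-- The sites in the order of the chain, after the first `k` of them have been moved to the
front. -/
def rotated (N k : ℕ) : List (Fin N × Bool) :=
  ((List.finRange N).take k).reverse.map (fun n => (n, true)) ++
    ((List.finRange N).drop k).reverse.map (fun n => (n, false))

theorem rotated_split (n : Fin N) : ∃ l : List (Fin N × Bool), (l.map Prod.fst).Nodup ∧
    n ∉ l.map Prod.fst ∧ rotated N n = l ++ [(n, false)] ∧ rotated N (n + 1) = (n, true) :: l := by
  have hn : (n : ℕ) < (List.finRange N).length := by simp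
  have h1 : (List.finRange N).drop n = n :: (List.finRange N).drop (n + 1) := by
    rw [List.drop_eq_getElem_cons hn, List.getElem_finRange]
    rfl
  have h2 : (List.finRange N).take (n + 1) = (List.finRange N).take n ++ [n] := by
    rw [← List.take_concat_get' _ _ hn, List.getElem_finRange]
    rfl
  have hnd := List.nodup_finRange N
  rw [← List.take_append_drop n (List.finRange N), h1, List.nodup_append_comm, List.cons_append,
    List.nodup_cons, List.mem_append, not_or] at hnd
  obtain ⟨⟨hn1, hn2⟩, hnd⟩ := hnd
  refine ⟨((List.finRange N).take n).reverse.map (fun n => (n, true)) ++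
    ((List.finRange N).drop (n + 1)).reverse.map (fun n => (n, false)), ?_, ?_, ?_, ?_⟩
  · rw [List.nodup_append_comm] at hnd
    simpa [Function.comp_def, List.nodup_append, List.nodup_reverse] using hnd
  · simpa [Function.comp_def] using ⟨hn2, hn1⟩
  · simp [rotated, h1]
  · simp [rotated, h2]

/-- The product of the transfer matrices at the first `k` inhomogeneities. -/
def shiftOp (q : ℂ) (η : Fin N → ℂ) (k : ℕ) : Op N :=
  (((List.finRange N).take k).map fun j => transfer q η (η j)).prod

theorem shiftOp_succ (n : Fin N) :
    shiftOp q η (n + 1) = shiftOp q η n * transfer q η (η n) := by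
  have hn : (n : ℕ) < (List.finRange N).length := by simp
  rw [shiftOp, shiftOp, ← List.take_concat_get' _ _ hn, List.getElem_finRange, List.map_append,
    List.prod_append]
  simp

theorem chain_rotated_mul_shiftOp (hq : q ≠ 0) (hη : ∀ a, η a ≠ 0) {k : ℕ} (hk : k ≤ N) {z : ℂ}
    (hz : z ≠ 0) (i j : Fin 2) :
    chain q η (rotated N k) z i j * shiftOp q η k = shiftOp q η k * monodromy q η z i j := by
  induction k generalizing z i j with
  | zero =>
    rw [monodromy_eq_chain]
    simp [shiftOp, rotated]
  | succ k ih =>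
    have ih := fun {z} (hz : z ≠ 0) => ih (z := z) (by omega) hz
    obtain ⟨l, hl, hn, h1, h2⟩ := rotated_split (⟨k, hk⟩ : Fin N)
    -- The induction hypothesis at `η_k` carries the transfer matrix of the rotated chain to that of
    -- the original one.
    have hS := congrArg₂ (· + ·) (ih (hη ⟨k, hk⟩) 0 1) (ih (hη ⟨k, hk⟩) 1 0)
    simp only [← add_mul, ← mul_add] at hS
    have hV := shiftOp_succ (q := q) (η := η) ⟨k, hk⟩
    simp only at h1 h2 hV
    rw [hV, transfer, opB, opC, ← hS, h2, ← mul_assoc, h1, chain_rotate hq hη hl hn hz, ← h1,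
      mul_assoc, ih hz, ← mul_assoc]

/-- The solution of the inverse problem for `σᶻ`. -/
theorem pauliZ_mul_shiftOp (hq : q ≠ 0) (hη : ∀ a, η a ≠ 0) (n : Fin N) :
    localOp n pauliZ * shiftOp q η (n + 1) =
      shiftOp q η n * (opC q η (η n) - opB q η (η n)) := by
  obtain ⟨l, -, hn, h1, -⟩ := rotated_split n
  have hc := fun i j => chain_rotated_mul_shiftOp hq hη n.2.le (hη n) i j
  rw [shiftOp_succ, transfer, mul_add, opB, opC, ← hc, ← hc, mul_add, ← mul_assoc, ← mul_assoc, h1,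
    pauliZ_mul_chain hη hn, pauliZ_mul_chain hη hn, ← h1, smul_mul_assoc, smul_mul_assoc, hc, hc]
  simp [pauliZ, mul_sub]
  abel

theorem list_take_prod (t : Fin N → ℂ) (s : Finset (Fin N)) (k : ℕ)
    (hs : ∀ j, j ∈ s ↔ (j : ℕ) < k) :
    (((List.finRange N).take k).map t).prod = ∏ j ∈ s, t j := by
  have hnd : ((List.finRange N).take k).Nodup := (List.take_sublist _ _).nodup (List.nodup_finRange N)
  rw [← List.prod_toFinset _ hnd]
  refine Finset.prod_congr ?_ fun _ _ => rfl
  ext j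
  rw [List.mem_toFinset, hs, List.mem_take_iff_getElem]
  constructor
  · rintro ⟨i, hi, rfl⟩
    simpa using (lt_min_iff.1 hi).1
  · intro h
    exact ⟨j, by simp [h], by simp⟩

theorem vecMul_shiftOp {t : ℂ → ℂ} {u : State N} (hη : ∀ a, η a ≠ 0)
    (hu : IsLeftEigenstate q η t u) (n : Fin N) :
    u ᵥ* shiftOp q η n = (∏ j ∈ Finset.Iio n, t (η j)) • u := by
  rw [← list_take_prod (fun j => t (η j)) (Finset.Iio n) n (by simp), shiftOp]
  induction (List.finRange N).take n with
  | nil => simp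
  | cons m l ih =>
    simp only [List.map_cons, List.prod_cons]
    rw [← Matrix.vecMul_vecMul, hu.2 _ (hη m), Matrix.smul_vecMul, ih, smul_smul]

theorem shiftOp_mulVec {t : ℂ → ℂ} {v : State N} (hη : ∀ a, η a ≠ 0)
    (hv : IsRightEigenstate q η t v) (n : Fin N) :
    shiftOp q η (n + 1) *ᵥ v = (∏ j ∈ Finset.Iic n, t (η j)) • v := by
  rw [← list_take_prod (fun j => t (η j)) (Finset.Iic n) (n + 1)
    (by intro j; rw [Finset.mem_Iic, Fin.le_def, Nat.lt_succ_iff]), shiftOp]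
  induction (List.finRange N).take (n + 1) with
  | nil => simp
  | cons m l ih =>
    simp only [List.map_cons, List.prod_cons]
    rw [← Matrix.mulVec_mulVec, ih, Matrix.mulVec_smul, hv.2 _ (hη m), smul_smul, mul_comm]

/-- The form factor of `σᶻ` in terms of that of `C - B`. -/
theorem Generic.matrixElement_pauliZ (G : Generic q η) (hN : 0 < N) {t t' : ℂ → ℂ} {u v : State N}
    (hu : IsLeftEigenstate q η t u) (hv : IsRightEigenstate q η t' v) (n : Fin N) :
    matrixElement u (localOp n pauliZ) v =
      ((∏ h ∈ Finset.Iio n, t (η h)) * ∏ h ∈ Finset.Iic n, t' (η h / q)) /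
        (∏ h ∈ Finset.Iic n, aFun q η (η h) * dFun η (η h / q)) *
        matrixElement u (opC q η (η n) - opB q η (η n)) v := by
  have h1 := congrArg (fun M => u ⬝ᵥ (M *ᵥ v)) (pauliZ_mul_shiftOp G.hq G.hη n)
  simp only [← Matrix.mulVec_mulVec, shiftOp_mulVec G.hη hv] at h1
  rw [Matrix.dotProduct_mulVec u (shiftOp q η n), vecMul_shiftOp G.hη hu, Matrix.mulVec_smul,
    dotProduct_smul, smul_dotProduct, smul_eq_mul, smul_eq_mul] at h1
  -- This replaces division by the `t'(η_h)` by the factors `t'(η_h / q)`.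
  have h2 : ∏ h ∈ Finset.Iic n, aFun q η (η h) * dFun η (η h / q) =
      (∏ h ∈ Finset.Iic n, t' (η h)) * ∏ h ∈ Finset.Iic n, t' (η h / q) := by
    rw [← Finset.prod_mul_distrib]
    exact Finset.prod_congr rfl fun h _ => (G.eigenvalue_mul hN hv h).symm
  have h3 : ∏ h ∈ Finset.Iic n, aFun q η (η h) * dFun η (η h / q) ≠ 0 :=
    Finset.prod_ne_zero_iff.2 fun h _ => mul_ne_zero (G.aFun_ne_zero h) (G.dFun_ne_zero h)
  rw [matrixElement, matrixElement, div_mul_eq_mul_div, eq_div_iff h3, h2]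
  linear_combination (∏ h ∈ Finset.Iic n, t' (η h / q)) * h1

end Reconstruction

/-! ### Determinant representations -/

section Determinant

/-- Expansion along the border column: the cofactor of row `a` is minus the determinant of `M` with
that row replaced by the border row. -/
theorem det_bordered {ι R : Type*} [Fintype ι] [DecidableEq ι] [CommRing R] (M : Matrix ι ι R)
    (c r : ι → R) (d : R) :
    (Matrix.fromBlocks M (Matrix.of fun a (_ : Unit) => c a) (Matrix.of fun (_ : Unit) b => r b)
      (Matrix.of fun _ _ => d)).det = d * M.det - ∑ a, c a * (M.updateRow a r).det := by
  set A := Matrix.fromBlocks M (Matrix.of fun a (_ : Unit) => c a)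
    (Matrix.of fun (_ : Unit) b => r b) (Matrix.of fun _ _ => d) with hA
  have h1 : (A.updateRow (Sum.inr ()) (Pi.single (Sum.inr ()) 1)).det = M.det := by
    have : A.updateRow (Sum.inr ()) (Pi.single (Sum.inr ()) 1) =
        Matrix.fromBlocks M (Matrix.of fun a (_ : Unit) => c a) 0 1 := by
      ext (i | i) (j | j) <;> simp [A, Matrix.updateRow_apply]
    rw [this, Matrix.det_fromBlocks_zero₂₁, Matrix.det_one, mul_one]
  have h2 : ∀ a, (A.updateRow (Sum.inl a) (Pi.single (Sum.inr ()) 1)).det =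
      -(M.updateRow a r).det := by
    intro a
    -- Swapping row `a` with the border row makes the matrix block triangular; the swap gives the
    -- sign.
    have : A.updateRow (Sum.inl a) (Pi.single (Sum.inr ()) 1) =
        (Matrix.fromBlocks (M.updateRow a r)
          (Matrix.of fun b (_ : Unit) => if b = a then d else c b) 0 1).submatrix
          (Equiv.swap (Sum.inl a) (Sum.inr ())) id := by
      ext (i | i) (j | j)
      · by_cases hi : i = a
        · subst hi; simp
        · rw [Matrix.submatrix_apply, Equiv.swap_apply_of_ne_of_ne (by simpa using hi) (by simp)]
          simp [A, Matrix.updateRow_apply, hi]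
      · by_cases hi : i = a
        · subst hi; simp
        · rw [Matrix.submatrix_apply, Equiv.swap_apply_of_ne_of_ne (by simpa using hi) (by simp)]
          simp [A, Matrix.updateRow_apply, hi]
      · simp [A, Matrix.updateRow_apply]
      · simp [A, Matrix.updateRow_apply]
    rw [this, Matrix.det_permute, Equiv.Perm.sign_swap (by simp), Matrix.det_fromBlocks_zero₂₁,
      Matrix.det_one, mul_one]
    simp
  rw [Matrix.det_eq_sum_mul_adjugate_col A (Sum.inr ()), Fintype.sum_sum_type]
  simp only [Matrix.adjugate_apply, h2, Finset.univ_unique, Finset.sum_singleton,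
    PUnit.default_eq_unit, h1]
  simp [A]
  ring

variable {N : ℕ} {q : ℂ} {η : Fin N → ℂ}

theorem det_vandermonde_eq_vand (y : Fin N → ℂ) : (Matrix.vandermonde y).det = vand y := by
  rw [Matrix.det_vandermonde, vand]
  exact Finset.prod_comm' (by simp)

/-- Multilinearity in the rows: choosing one summand in each row is choosing a configuration, and
what remains is a Vandermonde determinant. -/
theorem det_sum_vandermonde (f y : Fin N → Fin 2 → ℂ) :
    (Matrix.of fun a (b : Fin N) => ∑ c, f a c * y a c ^ (b : ℕ)).det =
      ∑ h : Conf N, (∏ a, f a (h a)) * vand fun a => y a (h a) := by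
  have h1 := (Matrix.detRowAlternating (n := Fin N) (R := ℂ)).toMultilinearMap.map_sum
    (fun a (c : Fin 2) => f a c • fun b : Fin N => y a c ^ (b : ℕ))
  have h2 : (Matrix.of fun a (b : Fin N) => ∑ c, f a c * y a c ^ (b : ℕ)) =
      fun a => ∑ c : Fin 2, f a c • fun b : Fin N => y a c ^ (b : ℕ) := by
    ext a b
    simp [Finset.sum_apply]
  rw [h2]
  refine h1.trans (Finset.sum_congr rfl fun h _ => ?_)
  rw [MultilinearMap.map_smul_univ, smul_eq_mul, ← det_vandermonde_eq_vand]
  rfl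

/-- The diagonal weights of the scalar products of separate states. -/
def sepWeight (N : ℕ) (Qbar Q : ℂ → ℂ) (z : ℂ) : ℂ := Q z * Qbar z / omegaFun N z

theorem phiMatrix_eq (Qbar Q : ℂ → ℂ) : phiMatrix q η Qbar Q = Matrix.of fun a (b : Fin N) =>
    ∑ c : Fin 2, sepWeight N Qbar Q (η a / q ^ (c : ℕ)) *
      ((η a / q ^ (c : ℕ)) ^ 2) ^ (b : ℕ) := by
  ext a b
  simp only [phiMatrix, Matrix.of_apply, sepWeight, Finset.mul_sum]
  refine Finset.sum_congr rfl fun c _ => ?_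
  rw [div_pow, div_pow, ← pow_mul, ← pow_mul, ← pow_mul,
    show 2 * (b : ℕ) * c = c * (2 * b) by ring]
  ring

theorem Generic.dotProduct_eq_det (G : Generic q η) (hN : 0 < N) (Qbar Q : ℂ → ℂ) :
    leftState q η Qbar ⬝ᵥ rightState q η Q = (phiMatrix q η Qbar Q).det := by
  rw [phiMatrix_eq, det_sum_vandermonde (fun a c => sepWeight N Qbar Q (η a / q ^ (c : ℕ)))
    fun a c => (η a / q ^ (c : ℕ)) ^ 2, leftState, sum_dotProduct]
  refine Finset.sum_congr rfl fun h _ => ?_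
  rw [smul_dotProduct, G.dotProduct_rightState hN, sepCoeff_eq, smul_eq_mul, mul_right_comm,
    ← Finset.prod_mul_distrib]
  congr 1
  refine Finset.prod_congr rfl fun a _ => ?_
  rw [sepWeight, node]
  ring

theorem det_updateRow_phiMatrix (Qbar Q : ℂ → ℂ) (a : Fin N) (w z : ℂ) :
    ((phiMatrix q η Qbar Q).updateRow a fun b : Fin N => w * z ^ (b : ℕ)).det =
      ∑ h : Conf N, if h a = 0 then
        w * (∏ b ∈ Finset.univ.erase a, sepWeight N Qbar Q (node q η h b)) *
          vand (Function.update (fun b => node q η h b ^ 2) a z) else 0 := by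
  -- The new row is written as a sum over `c` supported at `c = 0`, which restricts the sum to `h a
  -- = 0`, as in the expansion of `C(z)`.
  have e : (phiMatrix q η Qbar Q).updateRow a (fun b : Fin N => w * z ^ (b : ℕ)) =
      Matrix.of fun a' (b : Fin N) => ∑ c : Fin 2,
        (if a' = a then (if c = 0 then w else 0) else sepWeight N Qbar Q (η a' / q ^ (c : ℕ))) *
        (if a' = a then z else (η a' / q ^ (c : ℕ)) ^ 2) ^ (b : ℕ) := by
    ext a' b
    rw [phiMatrix_eq, Matrix.updateRow_apply]
    by_cases ha : a' = a
    · simp [ha]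
    · simp only [Matrix.of_apply, ha, if_false]
  rw [e, det_sum_vandermonde (fun a' c =>
    if a' = a then (if c = 0 then w else 0) else sepWeight N Qbar Q (η a' / q ^ (c : ℕ)))
    fun a' c => if a' = a then z else (η a' / q ^ (c : ℕ)) ^ 2]
  refine Finset.sum_congr rfl fun h _ => ?_
  rw [← Finset.mul_prod_erase _ _ (Finset.mem_univ a), if_pos rfl]
  split_ifs with ha
  · congr 1
    · congr 1
      refine Finset.prod_congr rfl fun b hb => ?_
      rw [if_neg (Finset.ne_of_mem_erase hb), node]
    · congr 1
      ext b
      by_cases hb : b = a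
      · subst hb; simp
      · rw [if_neg hb, Function.update_of_ne hb, node]
  · simp

theorem Generic.opC_eq_sum_det (G : Generic q η) (hN : 0 < N) (Qbar Q : ℂ → ℂ) {z : ℂ}
    (hz : z ≠ 0) :
    leftState q η Qbar ⬝ᵥ (opC q η z *ᵥ rightState q η Q) =
      ∑ a, Q (η a / q) * Qbar (η a) * dFun η (η a / q) *
        ((phiMatrix q η Qbar Q).updateRow a fun b : Fin N =>
          (z ^ (N - 1))⁻¹ * (z ^ 2) ^ (b : ℕ)).det := by
  have hz' := pow_ne_zero (N - 1) hz
  refine mul_left_cancel₀ hz' ?_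
  simp only [det_updateRow_phiMatrix, leftState, sum_dotProduct, Finset.mul_sum, smul_dotProduct,
    smul_eq_mul]
  simp only [mul_left_comm (z ^ (N - 1)) (sepCoeff _ _ _ _), G.opC_rightState hN Q hz,
    Finset.mul_sum]
  rw [Finset.sum_comm]
  refine Finset.sum_congr rfl fun a _ => Finset.sum_congr rfl fun h _ => ?_
  split_ifs with ha
  -- The interpolation factor replaces the squared node at `a` by `z²` in the Vandermonde product,
  -- as the updated row does.
  · have hv := vand_update (fun b => node q η h b ^ 2) a (z ^ 2)
    simp only [node_of_eq_zero ha] at hv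
    have hP : ∏ b ∈ Finset.univ.erase a, (η a ^ 2 - node q η h b ^ 2) ≠ 0 := by
      refine Finset.prod_ne_zero_iff.2 fun b hb => sub_ne_zero.2 fun h' => ?_
      refine Finset.ne_of_mem_erase hb (G.node_sq_injective h ?_)
      simpa only [node_of_eq_zero ha] using h'.symm
    have hw : ∏ b ∈ Finset.univ.erase a, sepWeight N Qbar Q (node q η h b) =
        (∏ b ∈ Finset.univ.erase a, Q (node q η h b)) *
          ∏ b ∈ Finset.univ.erase a, (Qbar (node q η h b) / omegaFun N (node q η h b)) := by
      rw [← Finset.prod_mul_distrib]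
      exact Finset.prod_congr rfl fun b _ => mul_div_assoc _ _ _
    have ha' := pow_ne_zero (N - 1) (G.hη a)
    rw [sepCoeff_eq, ← Finset.mul_prod_erase _ _ (Finset.mem_univ a), node_of_eq_zero ha,
      omegaFun_eq hN, Finset.prod_mul_distrib, hw,
      Finset.prod_div_distrib (fun b => z ^ 2 - node q η h b ^ 2)]
    generalize ∏ b ∈ Finset.univ.erase a, (Qbar (node q η h b) / omegaFun N (node q η h b)) = W
    field_simp
    linear_combination (-(Qbar (η a) * Q (η a / q) * dFun η (η a / q)) *
      (∏ b ∈ Finset.univ.erase a, Q (node q η h b)) * W) * hv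
  · simp

theorem Generic.det_szMatrix (G : Generic q η) (hN : 0 < N) (t Qbar Q : ℂ → ℂ) (n : Fin N) :
    (szMatrix q η t Qbar Q n).det =
      t (η n) / 2 * (leftState q η Qbar ⬝ᵥ rightState q η Q) -
        leftState q η Qbar ⬝ᵥ (opC q η (η n) *ᵥ rightState q η Q) := by
  rw [szMatrix, det_bordered, G.dotProduct_eq_det hN, G.opC_eq_sum_det hN _ _ (G.hη n)]
  congr 1
  refine Finset.sum_congr rfl fun a _ => ?_
  have hx := pow_ne_zero (N - 1) (div_ne_zero (G.hη a) G.hq)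
  -- The exponent `2 b + 1 - N` is `2 b - (N - 1)`: the power of `η_n` to be divided out in
  -- `Generic.opC_eq_sum_det`.
  have hrow : (fun b : Fin N => η n ^ (2 * ((b : ℕ) : ℤ) + 1 - (N : ℤ))) =
      fun b : Fin N => (η n ^ (N - 1))⁻¹ * (η n ^ 2) ^ (b : ℕ) := by
    ext b
    rw [← pow_mul, ← zpow_natCast, ← zpow_natCast, ← zpow_neg, ← zpow_add₀ (G.hη n)]
    congr 1
    push_cast [Nat.cast_sub hN]
    ring
  rw [hrow]
  congr 1
  rw [omegaFun_eq hN, show (η a / q) ^ ((N : ℤ) - 1) = (η a / q) ^ (N - 1) from omegaFun_eq hN _,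
    div_mul_cancel₀ _ hx]

end Determinant

end AntiperiodicXXZ

end

/-! ### Assembly -/

theorem mainTheorem5 {N : ℕ} (hN : 0 < N) (q : ℂ) (hq : q ≠ 0) (hq2 : q ^ 2 ≠ 1)
    (η : Fin N → ℂ) (hη : ∀ a, η a ≠ 0)
    (hsov : ∀ a b : Fin N, a < b → ∀ j ∈ ({-1, 0, 1} : Set ℤ), η a ^ 2 ≠ q ^ (2 * j) * η b ^ 2)
    (t t' : ℂ → ℂ) (u v : AntiperiodicXXZ.State N)
    (hu : AntiperiodicXXZ.IsLeftEigenstate q η t u)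
    (hv : AntiperiodicXXZ.IsRightEigenstate q η t' v) :
    (∃ Qbar : ℂ → ℂ, AntiperiodicXXZ.IsLeftQ q η t Qbar ∧
      u = AntiperiodicXXZ.leftState q η Qbar) ∧
    (∃ Q : ℂ → ℂ, AntiperiodicXXZ.IsRightQ q η t' Q ∧
      v = AntiperiodicXXZ.rightState q η Q) ∧
    ∀ Qbar Q : ℂ → ℂ,
      AntiperiodicXXZ.IsLeftQ q η t Qbar → u = AntiperiodicXXZ.leftState q η Qbar →
      AntiperiodicXXZ.IsRightQ q η t' Q → v = AntiperiodicXXZ.rightState q η Q →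
      ∀ n : Fin N,
        AntiperiodicXXZ.matrixElement u
            (AntiperiodicXXZ.localOp n AntiperiodicXXZ.pauliZ) v =
          2 * (((∏ h ∈ Finset.Iio n, t (η h)) * ∏ h ∈ Finset.Iic n, t' (η h / q)) /
            -∏ h ∈ Finset.Iic n, AntiperiodicXXZ.aFun q η (η h) *
              AntiperiodicXXZ.dFun η (η h / q)) *
            (AntiperiodicXXZ.szMatrix q η t Qbar Q n).det := by
  have G := AntiperiodicXXZ.generic_of_lt hq hq2 hη hsov
  refine ⟨G.exists_leftQ hN hu, G.exists_rightQ hN hv, ?_⟩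
  rintro Qbar Q - hu' - hv' n
  -- Eliminating `B` turns the element of `C - B` into twice that of `C` minus `t(η_n)` times the
  -- scalar product, which is `-2 det S`; this is the origin of the `2` and the sign.
  have hT : u ⬝ᵥ (AntiperiodicXXZ.opC q η (η n) *ᵥ v) + u ⬝ᵥ (AntiperiodicXXZ.opB q η (η n) *ᵥ v) =
      t (η n) * (u ⬝ᵥ v) := by
    rw [← dotProduct_add, ← Matrix.add_mulVec, add_comm, Matrix.dotProduct_mulVec]
    exact (congrArg (· ⬝ᵥ v) (hu.2 (η n) (hη n))).trans (smul_dotProduct _ _ _)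
  rw [G.matrixElement_pauliZ hN hu hv, G.det_szMatrix hN, ← hu', ← hv', div_neg,
    AntiperiodicXXZ.matrixElement, Matrix.sub_mulVec, dotProduct_sub, eq_sub_of_add_eq' hT]
  ring
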